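/- For real numbers $\beta_1,\beta_2,\beta_3$ linearly independent over $\mathbb Q$ and positive, the (homogeneous) Jacobi--Perron expansion of $\beta=\beta^{(0)}=(\beta_1,\beta_2,\beta_3)$ is the sequence $(\beta^{(k)})_{k\ge 0}$ given by $$\beta^{(k+1)}=\left(\beta_2^{(k)}-\left\lfloor \tfrac{\beta_2^{(k)}}{\beta_1^{(k)}}\right\rfloor\beta_1^{(k)},\ \beta_3^{(k)}-\left\lfloor \tfrac{\beta_3^{(k)}}{\beta_1^{(k)}}\right\rfloor\beta_1^{(k)},\ \beta_1^{(k)}\right),$$ and its semiconvergents are the numbers $\beta_i^{(k)}-j\beta_1^{(k)}$ with $k\ge 0$, $i\in\{2,3\}$ and $0\le j\le \lfloor \beta_i^{(k)}/\beta_1^{(k)}\rfloor-1$. Let $K$ be a totally real number field and $\mathcal O$ an order in $K$. The signature of a nonzero $\alpha\in K$ is the family of the signs of $\sigma(\alpha)$, where $\sigma$ runs over the embeddings $K\to\mathbb R$. Let $\mathcal O^{\mathfrak s}$ be the set of nonzero elements of $\mathcal O$ of signature $\mathfrak s$. An element $\alpha\in\mathcal O^{\mathfrak s}$ is $\mathfrak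 s$-decomposable in $\mathcal O$ if $\alpha=\beta+\gamma$ for some $\beta,\gamma\in\mathcal O^{\mathfrak s}$, and $\mathfrak s$-indecomposable in $\mathcal O$ otherwise. **Theorem 1.4 (= Theorem 8.2).** (A) Let $a\ge 3$ be an integer and let $\rho''<\rho'<\rho$ be the roots of $x^3+(a-1)x^2-ax-1$, all of which are real. Then every semiconvergent of the Jacobi--Perron expansion of $(1,-\rho',\rho'^2)$ is $\mathfrak s$-indecomposable in the order $\mathbb Z[\rho']$ of $\mathbb Q(\rho')$, where $\mathfrak s$ is its signature. In contrast, the expansion of $(1,\rho,\rho^2)$ has a semiconvergent that is $\mathfrak s$-decomposable in its signature $\mathfrak s$ in $\mathbb Z[\rho]$, and the expansion of $(1,-\rho'',\rho''^2)$ has a semiconvergent that is $\mathfrak s$-decomposable in its signature $\mathfrak s$ in $\mathbb Z[\rho'']$. (B) Let $a\ge 5$ be an integer and let $\psi'<\psi''<\psi$ be the roots of $x^3-(a-1)x^2-ax-1$, all of which are real. Then every semiconvergent of the Jacobi--Perron expansion of $(1,-\psi',\psi'^2)$ is $\mathfrak s$-indecomposable in its signature $\mathfrak s$ in the order $\mathbb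 Z[\psi']$ of $\mathbb Q(\psi')$, and every semiconvergent of the expansion of $(1,-\psi'',\psi''^2)$ is $\mathfrak s$-indecomposable in its signature $\mathfrak s$ in the order $\mathbb Z[\psi'']$ of $\mathbb Q(\psi'')$. In contrast, the expansion of $(1,\psi,\psi^2)$ has a semiconvergent that is $\mathfrak s$-decomposable in its signature $\mathfrak s$ in $\mathbb Z[\psi]$. -/

import Mathlib

open scoped IntermediateField

noncomputable section

/-! ### The homogeneous Jacobi--Perron algorithm -/

/-- One step of the homogeneous Jacobi--Perron algorithm in dimension `n = m + 1`:
`(β₁, …, βₙ) ↦ (β₂ - ⌊β₂ / β₁⌋ β₁, …, βₙ - ⌊βₙ / β₁⌋ β₁, β₁)`.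
Coordinates are indexed from `0`, so `β₁` is `v 0`. -/
def jpaStep {m : ℕ} (v : Fin (m + 1) → ℝ) : Fin (m + 1) → ℝ :=
  Fin.snoc (α := fun _ => ℝ)
    (fun i : Fin m => v i.succ - (⌊v i.succ / v 0⌋ : ℝ) * v 0) (v 0)

/-- The Jacobi--Perron expansion `⟨β⁽ᵏ⁾⟩` of the vector `β = β⁽⁰⁾`. -/
def jpa {m : ℕ} (β : Fin (m + 1) → ℝ) (k : ℕ) : Fin (m + 1) → ℝ :=
  jpaStep^[k] β

/-- The semiconvergents of the Jacobi--Perron expansion of `β`: the numbers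
`βᵢ⁽ᵏ⁾ - j β₁⁽ᵏ⁾` with `k ≥ 0`, `2 ≤ i ≤ n` and `0 ≤ j ≤ ⌊βᵢ⁽ᵏ⁾ / β₁⁽ᵏ⁾⌋ - 1`. -/
def jpaSemiconvergents {m : ℕ} (β : Fin (m + 1) → ℝ) : Set ℝ :=
  {δ | ∃ (k : ℕ) (i : Fin m) (j : ℕ),
    (j : ℤ) ≤ ⌊jpa β k i.succ / jpa β k 0⌋ - 1 ∧
    δ = jpa β k i.succ - (j : ℝ) * jpa β k 0}

/-! ### Signatures and indecomposable elements of an order -/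

section Signature

variable {K : Type*} [Field K]

/-- The signature of `α`: the family of signs of `σ α`, where `σ` runs through the
embeddings of `K` into `ℝ`. -/
def signature (α : K) : (K →+* ℝ) → SignType :=
  fun σ => SignType.sign (σ α)

/-- The set `O^s` of (nonzero) elements of `O` with signature `s`. -/
def elementsOfSignature (O : Subalgebra ℤ K) (s : (K →+* ℝ) → SignType) : Set K :=
  {α | α ∈ O ∧ α ≠ 0 ∧ signature α = s}

/-- `α` is `s`-indecomposable in `O`: it lies in `O^s` and is not a sum of two elements
of `O^s`. -/
def IsSIndecomposable (O : Subalgebra ℤ K) (s : (K →+* ℝ) → SignType) (α : K) : Prop :=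
  α ∈ elementsOfSignature O s ∧
    ¬ ∃ β ∈ elementsOfSignature O s, ∃ γ ∈ elementsOfSignature O s, α = β + γ

/-- `α` is `s`-decomposable in `O`: it lies in `O^s` and is a sum of two elements of `O^s`. -/
def IsSDecomposable (O : Subalgebra ℤ K) (s : (K →+* ℝ) → SignType) (α : K) : Prop :=
  α ∈ elementsOfSignature O s ∧
    ∃ β ∈ elementsOfSignature O s, ∃ γ ∈ elementsOfSignature O s, α = β + γ

/-- The ring `ℤ[x] ⊆ K`. -/
def zAdjoin (x : K) : Subalgebra ℤ K := Algebra.adjoin ℤ {x}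

end Signature

/-- The real number `δ` is an element of the field `ℚ(θ) ⊆ ℝ` which is indecomposable, in its
own signature, in the order `ℤ[θ]` of `ℚ(θ)`. -/
def IndecomposableInItsSignature (θ δ : ℝ) : Prop :=
  ∃ α : ℚ⟮θ⟯, (α : ℝ) = δ ∧
    IsSIndecomposable (zAdjoin (IntermediateField.AdjoinSimple.gen ℚ θ)) (signature α) α

/-- The real number `δ` is an element of the field `ℚ(θ) ⊆ ℝ` which is decomposable, in its
own signature, in the order `ℤ[θ]` of `ℚ(θ)`. -/
def DecomposableInItsSignature (θ δ : ℝ) : Prop :=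
  ∃ α : ℚ⟮θ⟯, (α : ℝ) = δ ∧
    IsSDecomposable (zAdjoin (IntermediateField.AdjoinSimple.gen ℚ θ)) (signature α) α

/-- `ρ > ρ' > ρ''` are the roots of `x³ + (a - 1) x² - a x - 1`. -/
def AreEnnolaRootsFirst (a : ℕ) (ρ ρ' ρ'' : ℝ) : Prop :=
  (ρ ^ 3 + ((a : ℝ) - 1) * ρ ^ 2 - a * ρ - 1 = 0) ∧
  (ρ' ^ 3 + ((a : ℝ) - 1) * ρ' ^ 2 - a * ρ' - 1 = 0) ∧
  (ρ'' ^ 3 + ((a : ℝ) - 1) * ρ'' ^ 2 - a * ρ'' - 1 = 0) ∧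
  ρ'' < ρ' ∧ ρ' < ρ

/-- `ψ > ψ'' > ψ'` are the roots of `x³ - (a - 1) x² - a x - 1`
(note the order of `ψ'` and `ψ''`). -/
def AreEnnolaRootsSecond (a : ℕ) (ψ ψ' ψ'' : ℝ) : Prop :=
  (ψ ^ 3 - ((a : ℝ) - 1) * ψ ^ 2 - a * ψ - 1 = 0) ∧
  (ψ' ^ 3 - ((a : ℝ) - 1) * ψ' ^ 2 - a * ψ' - 1 = 0) ∧
  (ψ'' ^ 3 - ((a : ℝ) - 1) * ψ'' ^ 2 - a * ψ'' - 1 = 0) ∧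
  ψ' < ψ'' ∧ ψ'' < ψ

end

/-! The order is studied inside `ℝ³` as `ℤ[t]`, with `t` the triple of conjugates of the root up to
sign.

Indecomposability is certified by duality. By Lagrange interpolation an integral linear form `L = A
u + B v + C w` on the elements `β = u + v t + w t²` is a trace `∑ hᵢ βᵢ / f'(tᵢ)`, where `f` is the
cubic and `hᵢ = A tⱼ tₖ - B (tⱼ + tₖ) + C`. If every `hᵢ / f'(tᵢ)` has the sign of `αᵢ`, then `L` is
positive, hence at least `1`, on all elements of the order with the signature of `α`. So `L(α) = 1`
excludes a decomposition (`signIndecomposable_of_form`). Only `1 + t` in the second family is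
treated with two forms of value `2`.

The cubic reads `t (1 + t) (a - t) = 1` or `t (1 - t) (a + t) = 1`, so `t` and `1 ± t` are units,
and multiplication by a unit preserves indecomposability. The algorithm is homogeneous, and the
three expansions in question are periodic up to a unit factor. Hence finitely many families of
semiconvergents, such as `1 - j t`, have to be given a form.

For the other roots an early semiconvergent is split explicitly, and the cubic shows that the two
summands have equal signs at all three roots.

The passage to `ℚ(θ)` rests on the cubic having no rational root: the real embeddings then send the
generator to each of the three roots. -/

/-! ### Elements of an order, seen through its real embeddings -/

/-- `α` lies in the subring `O` of `ℝ × ℝ × ℝ`, has no zero coordinate, and is not a sum of two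
elements of `O` with the same signs. -/
def SignIndecomposable (O : Subalgebra ℤ (Fin 3 → ℝ)) (α : Fin 3 → ℝ) : Prop :=
  α ∈ O ∧ (∀ i, α i ≠ 0) ∧ ∀ β ∈ O, ∀ γ ∈ O,
    (∀ i, 0 < α i * β i) → (∀ i, 0 < α i * γ i) → α ≠ β + γ

/-- `δ` is the `i`-th coordinate of a `SignIndecomposable` element of `O`. -/
def IndecomposableCoord (O : Subalgebra ℤ (Fin 3 → ℝ)) (i : Fin 3) (δ : ℝ) : Prop :=
  ∃ α, SignIndecomposable O α ∧ α i = δ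

/-- `c` is the `i`-th coordinate of a unit of `O`. -/
def UnitCoord (O : Subalgebra ℤ (Fin 3 → ℝ)) (i : Fin 3) (c : ℝ) : Prop :=
  ∃ ε ∈ O, ∃ ε' ∈ O, ε * ε' = 1 ∧ ε i = c

theorem UnitCoord.mul {O : Subalgebra ℤ (Fin 3 → ℝ)} {i : Fin 3} {c d : ℝ}
    (hc : UnitCoord O i c) (hd : UnitCoord O i d) : UnitCoord O i (c * d) := by
  obtain ⟨ε, hε, ε', hε', h, rfl⟩ := hc
  obtain ⟨η, hη, η', hη', h', rfl⟩ := hd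
  exact ⟨ε * η, mul_mem hε hη, ε' * η', mul_mem hε' hη', by
    rw [mul_mul_mul_comm, h, h', one_mul], rfl⟩

theorem UnitCoord.one {O : Subalgebra ℤ (Fin 3 → ℝ)} {i : Fin 3} : UnitCoord O i 1 :=
  ⟨1, one_mem _, 1, one_mem _, one_mul _, rfl⟩

theorem UnitCoord.inv {O : Subalgebra ℤ (Fin 3 → ℝ)} {i : Fin 3} {c : ℝ}
    (hc : UnitCoord O i c) : UnitCoord O i c⁻¹ := by
  obtain ⟨ε, hε, ε', hε', h, rfl⟩ := hc
  refine ⟨ε', hε', ε, hε, by rw [mul_comm, h], ?_⟩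
  exact eq_inv_of_mul_eq_one_right (congrFun h i)

/-- Multiplication by a unit permutes the order and carries one signature class onto another;
dividing a decomposition by the unit brings it back to `α`. -/
theorem SignIndecomposable.unit_mul {O : Subalgebra ℤ (Fin 3 → ℝ)} {ε ε' α : Fin 3 → ℝ}
    (hε : ε ∈ O) (hε' : ε' ∈ O) (h : ε * ε' = 1) (hα : SignIndecomposable O α) :
    SignIndecomposable O (ε * α) := by
  have hi : ∀ i, ε i * ε' i = 1 := fun i => congrFun h i
  have h0 : ∀ i, ε' i ≠ 0 := fun i => right_ne_zero_of_mul_eq_one (hi i)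
  have key : ∀ (β : Fin 3 → ℝ), (∀ i, 0 < (ε * α) i * β i) → ∀ i, 0 < α i * (ε' * β) i := by
    intro β hβ i
    have h1 : α i * (ε' * β) i = ε' i ^ 2 * ((ε * α) i * β i) := by
      simp only [Pi.mul_apply]
      linear_combination (-(α i * ε' i * β i)) * hi i
    rw [h1]
    have := hβ i
    have := h0 i
    positivity
  refine ⟨mul_mem hε hα.1, fun i => mul_ne_zero (left_ne_zero_of_mul_eq_one (hi i)) (hα.2.1 i), ?_⟩
  intro β hβ γ hγ hb hc heq
  refine hα.2.2 _ (mul_mem hε' hβ) _ (mul_mem hε' hγ) (key β hb) (key γ hc) ?_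
  rw [← mul_add, ← heq, ← mul_assoc, mul_comm ε', h, one_mul]

theorem IndecomposableCoord.unit_mul {O : Subalgebra ℤ (Fin 3 → ℝ)} {i : Fin 3} {c x : ℝ}
    (hx : IndecomposableCoord O i x) (hc : UnitCoord O i c) : IndecomposableCoord O i (c * x) := by
  obtain ⟨ε, hε, ε', hε', h, rfl⟩ := hc
  obtain ⟨α, hα, rfl⟩ := hx
  exact ⟨ε * α, hα.unit_mul hε hε' h, rfl⟩

theorem IndecomposableCoord.of_one {O : Subalgebra ℤ (Fin 3 → ℝ)} {i : Fin 3} {c : ℝ}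
    (h1 : IndecomposableCoord O i 1) (hc : UnitCoord O i c) : IndecomposableCoord O i c := by
  simpa using h1.unit_mul hc

/-! ### Integral generators of degree three -/

theorem exists_coords_of_mem_adjoin {R : Type*} [CommRing R] {t : R} {p q s : ℤ}
    (ht : t ^ 3 = p * t ^ 2 + q * t + s) {x : R} (hx : x ∈ Algebra.adjoin ℤ {t}) :
    ∃ u v w : ℤ, x = u + v * t + w * t ^ 2 := by
  induction hx using Algebra.adjoin_induction with
  | mem y hy => exact ⟨0, 1, 0, by rw [Set.mem_singleton_iff.1 hy]; simp⟩
  | algebraMap n => exact ⟨n, 0, 0, by simp⟩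
  | add y z _ _ hy hz =>
    obtain ⟨u, v, w, rfl⟩ := hy
    obtain ⟨u', v', w', rfl⟩ := hz
    exact ⟨u + u', v + v', w + w', by push_cast; ring⟩
  | mul y z _ _ hy hz =>
    obtain ⟨u, v, w, rfl⟩ := hy
    obtain ⟨u', v', w', rfl⟩ := hz
    -- The coefficients come from reducing `t³` and `t⁴ = (p² + q) t² + (p q + s) t + p s`.
    refine ⟨u * u' + (v * w' + w * v') * s + w * w' * p * s,
      u * v' + v * u' + (v * w' + w * v') * q + w * w' * (p * q + s),
      u * w' + v * v' + w * u' + (v * w' + w * v') * p + w * w' * (p ^ 2 + q), ?_⟩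
    push_cast
    linear_combination ((v * w' + w * v' : R) + w * w' * (t + p)) * ht

theorem adjoin_neg_eq {R : Type*} [CommRing R] (t : R) :
    Algebra.adjoin ℤ {-t} = Algebra.adjoin ℤ {t} := by
  apply le_antisymm <;> rw [Algebra.adjoin_le_iff, Set.singleton_subset_iff]
  · exact neg_mem (Algebra.self_mem_adjoin_singleton ℤ t)
  · simpa using neg_mem (Algebra.self_mem_adjoin_singleton ℤ (-t))

theorem adjoin_one_sub_eq {R : Type*} [CommRing R] (t : R) :
    Algebra.adjoin ℤ {1 - t} = Algebra.adjoin ℤ {t} := by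
  apply le_antisymm <;> rw [Algebra.adjoin_le_iff, Set.singleton_subset_iff]
  · exact sub_mem (one_mem _) (Algebra.self_mem_adjoin_singleton ℤ t)
  · simpa using sub_mem (one_mem _) (Algebra.self_mem_adjoin_singleton ℤ (1 - t))

theorem coords_mem_adjoin {R : Type*} [CommRing R] (t : R) (u v w : ℤ) :
    (u + v * t + w * t ^ 2 : R) ∈ Algebra.adjoin ℤ {t} := by
  have ht := Algebra.self_mem_adjoin_singleton ℤ t
  exact add_mem (add_mem (intCast_mem _ u) (mul_mem (intCast_mem _ v) ht))
    (mul_mem (intCast_mem _ w) (pow_mem ht 2))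

/-- A positive linear combination of the conjugates takes a positive value. -/
theorem form_pos {t₀ t₁ t₂ : ℝ} (h01 : 0 < (t₁ - t₀) * (t₁ - t₂)) (h0 : (t₀ - t₁) * (t₀ - t₂) < 0)
    (h02 : 0 < (t₂ - t₀) * (t₂ - t₁)) {A B C : ℝ} {α : Fin 3 → ℝ}
    (hα0 : α 0 * (A * (t₁ * t₂) - B * (t₁ + t₂) + C) < 0)
    (hα1 : 0 < α 1 * (A * (t₀ * t₂) - B * (t₀ + t₂) + C))
    (hα2 : 0 < α 2 * (A * (t₀ * t₁) - B * (t₀ + t₁) + C)) {u v w : ℝ}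
    (hβ0 : 0 < α 0 * (u + v * t₀ + w * t₀ ^ 2)) (hβ1 : 0 < α 1 * (u + v * t₁ + w * t₁ ^ 2))
    (hβ2 : 0 < α 2 * (u + v * t₂ + w * t₂ ^ 2)) : 0 < A * u + B * v + C * w := by
  have aux : ∀ {x h d y : ℝ}, 0 < x * h * d → 0 < x * y → 0 < h * y / d := by
    intro x h d y h1 h2
    have hx : x ≠ 0 := by rintro rfl; simp at h2
    have hd : d ≠ 0 := by rintro rfl; simp at h1
    have : h * y / d = (x * h * d) * (x * y) / (x * d) ^ 2 := by field_simp
    rw [this]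
    positivity
  -- Lagrange interpolation: the basis dual to `1, t, t²` under the trace has the components `tⱼ
  -- tₖ`, `-(tⱼ + tₖ)`, `1`, each divided by `f'(tᵢ)`. The middle root `t₀` is the one with `f' <
  -- 0`, which explains the reversed sign in its hypothesis.
  have e : A * u + B * v + C * w =
      (A * (t₁ * t₂) - B * (t₁ + t₂) + C) * (u + v * t₀ + w * t₀ ^ 2) / ((t₀ - t₁) * (t₀ - t₂)) +
      (A * (t₀ * t₂) - B * (t₀ + t₂) + C) * (u + v * t₁ + w * t₁ ^ 2) / ((t₁ - t₀) * (t₁ - t₂)) +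
      (A * (t₀ * t₁) - B * (t₀ + t₁) + C) * (u + v * t₂ + w * t₂ ^ 2) / ((t₂ - t₀) * (t₂ - t₁)) := by
    have n1 : t₀ - t₁ ≠ 0 := fun h => by simp [h] at h0
    have n2 : t₀ - t₂ ≠ 0 := fun h => by simp [h] at h0
    have n3 : t₁ - t₂ ≠ 0 := fun h => by simp [h] at h01
    have n4 : t₁ - t₀ ≠ 0 := fun h => by simp [h] at h01
    have n5 : t₂ - t₀ ≠ 0 := fun h => by simp [h] at h02
    have n6 : t₂ - t₁ ≠ 0 := fun h => by simp [h] at h02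
    rw [show t₁ - t₀ = -(t₀ - t₁) by ring, show t₂ - t₀ = -(t₀ - t₂) by ring,
      show t₂ - t₁ = -(t₁ - t₂) by ring]
    field_simp
    ring
  rw [e]
  exact add_pos (add_pos (aux (mul_pos_of_neg_of_neg hα0 h0) hβ0) (aux (mul_pos hα1 h01) hβ1))
    (aux (mul_pos hα2 h02) hβ2)

/-- An element on which some positive integral linear form takes the value one is
indecomposable. -/
theorem signIndecomposable_of_form {t : Fin 3 → ℝ} {p q s : ℤ}
    (ht : t ^ 3 = p * t ^ 2 + q * t + s)
    (h01 : 0 < (t 1 - t 0) * (t 1 - t 2)) (h0 : (t 0 - t 1) * (t 0 - t 2) < 0)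
    (h02 : 0 < (t 2 - t 0) * (t 2 - t 1)) (A B C : ℤ) (u v w : ℤ) {α : Fin 3 → ℝ}
    (hα : ∀ i, α i = u + v * t i + w * t i ^ 2)
    (hα0 : α 0 * (A * (t 1 * t 2) - B * (t 1 + t 2) + C) < 0)
    (hα1 : 0 < α 1 * (A * (t 0 * t 2) - B * (t 0 + t 2) + C))
    (hα2 : 0 < α 2 * (A * (t 0 * t 1) - B * (t 0 + t 1) + C))
    (hL : A * u + B * v + C * w = 1) :
    SignIndecomposable (Algebra.adjoin ℤ {t}) α := by
  have key : ∀ u' v' w' : ℤ, (∀ i, 0 < α i * (u' + v' * t i + w' * t i ^ 2)) →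
      0 < A * u' + B * v' + C * w' := fun u' v' w' hs => by
    exact_mod_cast form_pos h01 h0 h02 hα0 hα1 hα2 (hs 0) (hs 1) (hs 2)
  refine ⟨?_, ?_, ?_⟩
  · have : α = u + v * t + w * t ^ 2 := by ext i; simp [hα]
    rw [this]
    exact coords_mem_adjoin t u v w
  · intro i
    fin_cases i
    · exact left_ne_zero_of_mul hα0.ne
    · exact left_ne_zero_of_mul hα1.ne'
    · exact left_ne_zero_of_mul hα2.ne'
  · intro β hβ γ hγ hb hc heq
    obtain ⟨u', v', w', rfl⟩ := exists_coords_of_mem_adjoin ht hβ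
    -- Each summand has form value at least `1`, although the two values add up to `1`.
    have l₁ := key u' v' w' fun i => by simpa using hb i
    have l₂ := key (u - u') (v - v') (w - w') fun i => by
      have h1 := hc i
      have h2 := congrFun heq i
      simp only [Pi.add_apply, Pi.mul_apply, Pi.intCast_apply, Pi.pow_apply] at h2
      convert h1 using 2
      rw [hα] at h2
      push_cast
      linear_combination h2
    linarith

/-! ### Transfer to the field generated by a root -/

-- Since the constant term is `-1`, only `1` and `-1` can be rational roots; the values there are `b
-- + c` and `b - c - 2`.
open Polynomial in
theorem irreducible_cubic {b c : ℤ} (h1 : b + c ≠ 0) (h2 : b - c ≠ 2) :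
    Irreducible (X ^ 3 + C (b : ℚ) * X ^ 2 + C (c : ℚ) * X + C (-1) : ℚ[X]) := by
  set f : ℚ[X] := X ^ 3 + C (b : ℚ) * X ^ 2 + C (c : ℚ) * X + C (-1) with hf
  have hdeg : f.natDegree = 3 := by rw [hf]; compute_degree!
  rw [Polynomial.irreducible_iff_roots_eq_zero_of_degree_le_three (by omega) (by omega)]
  have hf0 : f ≠ 0 := by rintro h; simp [h] at hdeg
  refine Multiset.eq_zero_of_forall_notMem fun x hx => ?_
  have hx' : x ^ 3 + b * x ^ 2 + c * x - 1 = 0 := by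
    have := (Polynomial.mem_roots hf0).1 hx
    simp only [hf, IsRoot.def, eval_add, eval_pow, eval_X, eval_mul, eval_C] at this
    linear_combination this
  have hint : IsIntegral ℤ x := by
    refine ⟨X ^ 3 + C b * X ^ 2 + C c * X + C (-1), ?_, ?_⟩
    · monicity!
    · simp only [eval₂_add, eval₂_mul, eval₂_pow, eval₂_X, eval₂_C]
      simp only [algebraMap_int_eq, eq_intCast]
      push_cast
      linear_combination hx'
  obtain ⟨n, rfl⟩ := IsIntegrallyClosed.isIntegral_iff.1 hint
  simp only [algebraMap_int_eq, eq_intCast] at hx'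
  have hn : n * (n ^ 2 + b * n + c) = 1 := by
    have : ((n * (n ^ 2 + b * n + c) : ℤ) : ℚ) = (1 : ℤ) := by
      push_cast
      linear_combination hx'
    exact_mod_cast this
  rcases Int.eq_one_or_neg_one_of_mul_eq_one hn with rfl | rfl
  · apply h1; linarith
  · apply h2; linarith

section Bridge

open Polynomial IntermediateField

variable {r : Fin 3 → ℝ} {b c : ℤ} {i : Fin 3}

theorem exists_embedding (h1 : b + c ≠ 0) (h2 : b - c ≠ 2)
    (hr : ∀ j, r j ^ 3 + b * r j ^ 2 + c * r j - 1 = 0) (j : Fin 3) :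
    ∃ σ : ℚ⟮r i⟯ →+* ℝ, σ (AdjoinSimple.gen ℚ (r i)) = r j := by
  set f : ℚ[X] := X ^ 3 + C (b : ℚ) * X ^ 2 + C (c : ℚ) * X + C (-1) with hf
  have hroot : ∀ j, aeval (r j) f = 0 := fun j => by
    simp [hf]
    linear_combination hr j
  have hmonic : f.Monic := by rw [hf]; monicity!
  have hint : IsIntegral ℚ (r i) := ⟨f, hmonic, hroot i⟩
  have hmin : minpoly ℚ (r i) = f :=
    (minpoly.eq_of_irreducible_of_monic (irreducible_cubic h1 h2) (hroot i) hmonic).symm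
  have hlift : aeval (r j) (minpoly ℚ (adjoin.powerBasis hint).gen) = 0 := by
    have hgen : minpoly ℚ (adjoin.powerBasis hint).gen = f := by
      rw [adjoin.powerBasis_gen, ← hmin]
      exact minpoly_gen ℚ (r i)
    rw [hgen, hroot]
  refine ⟨((adjoin.powerBasis hint).lift (r j) hlift).toRingHom, ?_⟩
  have := (adjoin.powerBasis hint).lift_gen (r j) hlift
  rwa [adjoin.powerBasis_gen] at this

theorem embedding_gen_eq (hr : ∀ x : ℝ, x ^ 3 + b * x ^ 2 + c * x - 1 =
      (x - r 0) * (x - r 1) * (x - r 2)) (σ : ℚ⟮r i⟯ →+* ℝ) :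
    ∃ j, σ (AdjoinSimple.gen ℚ (r i)) = r j := by
  have hi : r i ^ 3 + b * r i ^ 2 + c * r i - 1 = 0 := by
    rw [hr]; fin_cases i <;> simp
  set g := AdjoinSimple.gen ℚ (r i) with hg
  have hgi : g ^ 3 + b * g ^ 2 + c * g - 1 = 0 := by
    apply Subtype.ext
    simpa [hg] using hi
  have h := congrArg σ hgi
  simp only [map_sub, map_add, map_mul, map_pow, map_intCast, map_one, map_zero] at h
  rw [hr, mul_eq_zero, mul_eq_zero, sub_eq_zero, sub_eq_zero, sub_eq_zero] at h
  rcases h with (h | h) | h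
  exacts [⟨0, h⟩, ⟨1, h⟩, ⟨2, h⟩]

theorem embedding_aeval {x : ℝ} {σ : ℚ⟮x⟯ →+* ℝ} {j : Fin 3}
    (hσ : σ (AdjoinSimple.gen ℚ x) = r j) (P : ℤ[X]) :
    σ (aeval (AdjoinSimple.gen ℚ x) P) = aeval r P j := by
  have h1 := aeval_algHom_apply σ.toIntAlgHom (AdjoinSimple.gen ℚ x) P
  have h2 := aeval_algHom_apply (Pi.evalAlgHom ℤ (fun _ : Fin 3 => ℝ) j) r P
  calc σ (aeval (AdjoinSimple.gen ℚ x) P) = aeval (σ (AdjoinSimple.gen ℚ x)) P := h1.symm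
    _ = aeval (r j) P := by rw [hσ]
    _ = aeval r P j := h2

theorem coe_aeval_gen (P : ℤ[X]) :
    ((aeval (AdjoinSimple.gen ℚ (r i)) P : ℚ⟮r i⟯) : ℝ) = aeval r P i :=
  embedding_aeval (σ := (algebraMap ℚ⟮r i⟯ ℝ)) (AdjoinSimple.algebraMap_gen ℚ (r i)) P

theorem aeval_mem_zAdjoin {K : Type*} [Field K] (x : K) (P : ℤ[X]) : aeval x P ∈ zAdjoin x :=
  aeval_mem_adjoin_singleton ℤ x

theorem sign_eq_of_mul_pos {x y : ℝ} (h : 0 < x * y) : SignType.sign y = SignType.sign x := by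
  rcases mul_pos_iff.1 h with ⟨h1, h2⟩ | ⟨h1, h2⟩
  · rw [sign_pos h1, sign_pos h2]
  · rw [sign_neg h1, sign_neg h2]

theorem mul_pos_of_sign_eq {x y : ℝ} (hx : x ≠ 0) (h : SignType.sign y = SignType.sign x) :
    0 < x * y := by
  rcases lt_or_gt_of_ne hx with h1 | h1
  · rw [sign_neg h1, sign_eq_neg_one_iff] at h
    exact mul_pos_of_neg_of_neg h1 h
  · rw [sign_pos h1, sign_eq_one_iff] at h
    exact mul_pos h1 h

/-- A decomposition in the field must yield one in `ℝ³`, so every root has to come from an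
embedding; this is where irreducibility enters. -/
theorem IndecomposableCoord.indecomposableInItsSignature {δ : ℝ}
    (h : IndecomposableCoord (Algebra.adjoin ℤ {r}) i δ) (h1 : b + c ≠ 0) (h2 : b - c ≠ 2)
    (hr : ∀ x : ℝ, x ^ 3 + b * x ^ 2 + c * x - 1 = (x - r 0) * (x - r 1) * (x - r 2)) :
    IndecomposableInItsSignature (r i) δ := by
  obtain ⟨α, ⟨hα, hα0, hind⟩, rfl⟩ := h
  rw [Algebra.adjoin_singleton_eq_range_aeval] at hα
  obtain ⟨P, rfl⟩ := hα
  have hroot : ∀ j, r j ^ 3 + b * r j ^ 2 + c * r j - 1 = 0 := fun j => by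
    rw [hr]; fin_cases j <;> simp
  refine ⟨aeval (AdjoinSimple.gen ℚ (r i)) P, coe_aeval_gen P,
    ⟨aeval_mem_zAdjoin _ P, fun h0 => hα0 i ?_, rfl⟩, ?_⟩
  · have := coe_aeval_gen (r := r) (i := i) P
    rw [h0] at this
    exact this.symm
  · rintro ⟨β, ⟨hβ, -, hsβ⟩, γ, ⟨hγ, -, hsγ⟩, heq⟩
    rw [zAdjoin, Algebra.adjoin_singleton_eq_range_aeval] at hβ hγ
    obtain ⟨U, rfl⟩ := hβ
    obtain ⟨V, rfl⟩ := hγ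
    have key : ∀ W : ℤ[X], signature (aeval (AdjoinSimple.gen ℚ (r i)) W) =
        signature (aeval (AdjoinSimple.gen ℚ (r i)) P) →
        ∀ j, 0 < aeval r P j * aeval r W j := by
      intro W hW j
      obtain ⟨σ, hσ⟩ := exists_embedding (i := i) h1 h2 hroot j
      have := congrFun hW σ
      simp only [signature, embedding_aeval hσ] at this
      exact mul_pos_of_sign_eq (hα0 j) this
    refine hind _ (aeval_mem_adjoin_singleton ℤ r) _ (aeval_mem_adjoin_singleton ℤ r)
      (key U hsβ) (key V hsγ) ?_
    funext j
    obtain ⟨σ, hσ⟩ := exists_embedding (i := i) h1 h2 hroot j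
    have := congrArg σ heq
    simp only [AlgHom.toRingHom_eq_coe, RingHom.coe_coe, map_add, embedding_aeval hσ] at this
    exact this

/-- Irreducibility plays no role here: each embedding sends the generator to some root, so equal
signs at the three roots are enough. -/
theorem decomposableInItsSignature_of_aeval {δ : ℝ} (hr : ∀ x : ℝ,
      x ^ 3 + b * x ^ 2 + c * x - 1 = (x - r 0) * (x - r 1) * (x - r 2)) (P Q : ℤ[X])
    (hPQ : ∀ j, 0 < aeval (r j) P * aeval (r j) Q) (hδ : aeval (r i) (P + Q) = δ) :
    DecomposableInItsSignature (r i) δ := by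
  have hev : ∀ (W : ℤ[X]) j, aeval r W j = aeval (r j) W := fun W j =>
    (aeval_algHom_apply (Pi.evalAlgHom ℤ (fun _ : Fin 3 => ℝ) j) r W).symm
  set g := AdjoinSimple.gen ℚ (r i) with hg
  have hsum : ∀ j, 0 < aeval (r j) (P + Q) * aeval (r j) P ∧
      0 < aeval (r j) (P + Q) * aeval (r j) Q := by
    intro j
    have := hPQ j
    rw [map_add, add_mul, add_mul, mul_comm (aeval (r j) Q)]
    constructor <;> nlinarith [mul_self_nonneg (aeval (r j) P), mul_self_nonneg (aeval (r j) Q)]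
  have hne : ∀ W : ℤ[X], aeval (r i) W ≠ 0 → aeval g W ≠ 0 := by
    intro W hW h0
    apply hW
    rw [← hev, ← coe_aeval_gen, ← hg, h0]
    rfl
  have hsig : ∀ W : ℤ[X], (∀ j, 0 < aeval (r j) (P + Q) * aeval (r j) W) →
      signature (aeval g W) = signature (aeval g (P + Q)) := by
    intro W hW
    funext σ
    obtain ⟨j, hj⟩ := embedding_gen_eq hr σ
    simp only [signature, hg, embedding_aeval hj, hev]
    exact sign_eq_of_mul_pos (hW j)
  refine ⟨aeval g (P + Q), by rw [hg, coe_aeval_gen, hev, hδ],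
    ⟨aeval_mem_zAdjoin _ _, hne _ (left_ne_zero_of_mul (hsum i).1.ne'), rfl⟩,
    aeval g P, ⟨aeval_mem_zAdjoin _ _, hne _ (right_ne_zero_of_mul (hsum i).1.ne'),
      hsig P fun j => (hsum j).1⟩,
    aeval g Q, ⟨aeval_mem_zAdjoin _ _, hne _ (right_ne_zero_of_mul (hsum i).2.ne'),
      hsig Q fun j => (hsum j).2⟩, map_add _ _ _⟩

end Bridge

/-! ### Running the Jacobi--Perron algorithm -/

/-- The semiconvergents that occur in the first `n` steps of the expansion of `v` have the
property `P`. -/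
def SemiconvergentsBefore {m : ℕ} (P : ℝ → Prop) (n : ℕ) (v : Fin (m + 1) → ℝ) : Prop :=
  ∀ k < n, ∀ (i : Fin m) (j : ℕ), (j : ℤ) ≤ ⌊jpa v k i.succ / jpa v k 0⌋ - 1 →
    P (jpa v k i.succ - (j : ℝ) * jpa v k 0)

theorem SemiconvergentsBefore.mono {m : ℕ} {P : ℝ → Prop} {n n' : ℕ} {v : Fin (m + 1) → ℝ}
    (h : SemiconvergentsBefore P n v) (hn : n' ≤ n) : SemiconvergentsBefore P n' v :=
  fun k hk => h k (hk.trans_le hn)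

theorem jpa_succ {m : ℕ} (v : Fin (m + 1) → ℝ) (k : ℕ) : jpa v (k + 1) = jpa (jpaStep v) k :=
  Function.iterate_succ_apply _ _ _

theorem jpaStep_smul {m : ℕ} {c : ℝ} (hc : c ≠ 0) (v : Fin (m + 1) → ℝ) :
    jpaStep (c • v) = c • jpaStep v := by
  funext i
  refine Fin.lastCases ?_ (fun i => ?_) i
  · simp [jpaStep]
  · simp only [jpaStep, Pi.smul_apply, smul_eq_mul, Fin.snoc_castSucc, mul_div_mul_left _ _ hc]
    ring

theorem jpa_smul {m : ℕ} {c : ℝ} (hc : c ≠ 0) (v : Fin (m + 1) → ℝ) (k : ℕ) :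
    jpa (c • v) k = c • jpa v k := by
  induction k generalizing v with
  | zero => rfl
  | succ k ih => rw [jpa_succ, jpa_succ, jpaStep_smul hc, ih]

/-- Partial quotients depend only on ratios of coordinates. With `c` a unit and `P`
indecomposability, a vector that recurs up to the factor `c` closes the period. -/
theorem SemiconvergentsBefore.smul {m : ℕ} {P : ℝ → Prop} {n : ℕ} {v : Fin (m + 1) → ℝ}
    (h : SemiconvergentsBefore P n v) {c : ℝ} (hc : c ≠ 0) (hP : ∀ x, P x → P (c * x)) :
    SemiconvergentsBefore P n (c • v) := by
  intro k hk i j hj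
  simp only [jpa_smul hc, Pi.smul_apply, smul_eq_mul, mul_div_mul_left _ _ hc] at hj ⊢
  have := hP _ (h k hk i j hj)
  rwa [mul_sub, mul_left_comm] at this

theorem jpaStep_three {x y z : ℝ} {p q : ℤ} (hp : ⌊y / x⌋ = p) (hq : ⌊z / x⌋ = q) :
    jpaStep ![x, y, z] = ![y - p * x, z - q * x, x] := by
  subst hp hq
  funext i
  fin_cases i <;> simp [jpaStep, Fin.snoc]

theorem floor_div_eq {x y : ℝ} {p : ℤ} (hx : 0 < x) (h0 : 0 ≤ y - p * x) (h1 : y - p * x < x) :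
    ⌊y / x⌋ = p := by
  rw [Int.floor_eq_iff, le_div_iff₀ hx, div_lt_iff₀ hx]
  constructor <;> linarith

/-- One step of the expansion of `(x, y, z)`, with partial quotients `p` and `q`, leading to
`c (x', y', z')`. -/
theorem SemiconvergentsBefore.step {P : ℝ → Prop} {n : ℕ} {x y z c x' y' z' : ℝ} (p q : ℕ)
    (h : SemiconvergentsBefore P n ![x', y', z']) (hc : 0 < c) (hP : ∀ s, P s → P (c * s))
    (hx : x = c * z') (hy : y = p * x + c * x') (hz : z = q * x + c * y')
    (hx0 : 0 ≤ x') (hx1 : x' < z') (hy0 : 0 ≤ y') (hy1 : y' < z')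
    (hPy : ∀ j < p, P (y - j * x)) (hPz : ∀ j < q, P (z - j * x)) :
    SemiconvergentsBefore P (n + 1) ![x, y, z] := by
  have hxpos : 0 < x := hx ▸ mul_pos hc (hx0.trans_lt hx1)
  have e1 : y - ((p : ℤ) : ℝ) * x = c * x' := by push_cast; linarith
  have e2 : z - ((q : ℤ) : ℝ) * x = c * y' := by push_cast; linarith
  have hp : ⌊y / x⌋ = (p : ℤ) := floor_div_eq hxpos (by rw [e1]; positivity)
    (by rw [e1, hx]; exact mul_lt_mul_of_pos_left hx1 hc)
  have hq : ⌊z / x⌋ = (q : ℤ) := floor_div_eq hxpos (by rw [e2]; positivity)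
    (by rw [e2, hx]; exact mul_lt_mul_of_pos_left hy1 hc)
  have hstep : jpaStep ![x, y, z] = c • ![x', y', z'] := by
    rw [jpaStep_three hp hq, e1, e2, hx]
    simp
  rintro (_ | k) hk i j hj
  · fin_cases i
    · have hj' : (j : ℤ) ≤ ⌊y / x⌋ - 1 := hj
      exact hPy j (by omega)
    · have hj' : (j : ℤ) ≤ ⌊z / x⌋ - 1 := hj
      exact hPz j (by omega)
  · rw [jpa_succ, hstep] at hj ⊢
    exact h.smul hc.ne' hP k (by omega) i j hj

theorem forall_semiconvergents {m : ℕ} {P : ℝ → Prop} {v : Fin (m + 1) → ℝ}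
    (h : ∀ n, SemiconvergentsBefore P n v) : ∀ δ ∈ jpaSemiconvergents v, P δ := by
  rintro δ ⟨k, i, j, hj, rfl⟩
  exact h (k + 1) k k.lt_succ_self i j hj

/-! ### The first family: `t (1 + t) (a - t) = 1` -/

theorem vieta_of_roots {b c d x y z : ℝ} (hx : x ^ 3 + b * x ^ 2 + c * x + d = 0)
    (hy : y ^ 3 + b * y ^ 2 + c * y + d = 0) (hz : z ^ 3 + b * z ^ 2 + c * z + d = 0)
    (hxy : x ≠ y) (hyz : y ≠ z) (hxz : x ≠ z) :
    x + y + z = -b ∧ x * y + x * z + y * z = c ∧ x * y * z = -d := by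
  have h1 : x ^ 2 + x * y + y ^ 2 + b * (x + y) + c = 0 :=
    mul_left_cancel₀ (sub_ne_zero.2 hxy) (by linear_combination hx - hy)
  have h2 : x ^ 2 + x * z + z ^ 2 + b * (x + z) + c = 0 :=
    mul_left_cancel₀ (sub_ne_zero.2 hxz) (by linear_combination hx - hz)
  have h3 : x + y + z = -b :=
    mul_left_cancel₀ (sub_ne_zero.2 hyz) (by linear_combination h1 - h2)
  have h4 : x * y + x * z + y * z = c := by linear_combination (x + y) * h3 - h1
  exact ⟨h3, h4, by linear_combination hx + (-x ^ 2) * h3 + x * h4⟩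

/-- `t 0`, `t 1`, `t 2` are the solutions of `x (1 + x) (a - x) = 1`; the first one is close
to `0`, the second one is close to `-1`, and the third one is close to `a`. -/
structure FirstConjugates (a : ℕ) (t : Fin 3 → ℝ) : Prop where
  three_le : (3 : ℝ) ≤ a
  root : ∀ i, t i * (1 + t i) * (a - t i) = 1
  sum : t 0 + t 1 + t 2 = a - 1
  prod : t 0 * t 1 * t 2 = -1
  zero_pos : 0 < t 0
  zero_lt : t 0 < 3 / 10
  one_lt : t 1 < -1
  lt_one : -(3 / 2) < t 1
  lt_two : a - 1 < t 2

namespace FirstConjugates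

variable {a : ℕ} {t : Fin 3 → ℝ}

theorem cube_eq (h : FirstConjugates a t) :
    t ^ 3 = ((a - 1 : ℤ) : Fin 3 → ℝ) * t ^ 2 + ((a : ℤ) : Fin 3 → ℝ) * t + ((-1 : ℤ) : Fin 3 → ℝ) := by
  funext i
  have := h.root i
  simp only [Pi.add_apply, Pi.mul_apply, Pi.pow_apply, Pi.intCast_apply]
  push_cast
  linear_combination -this

theorem one_sub_mul (h : FirstConjugates a t) : 1 - a * t 0 = t 0 ^ 2 * (a - 1 - t 0) := by
  linear_combination -h.root 0

theorem mul_lt_one (h : FirstConjugates a t) : a * t 0 < 1 := by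
  have h1 := h.one_sub_mul
  have h2 := h.zero_pos
  have : 0 < t 0 ^ 2 * (a - 1 - t 0) := mul_pos (pow_pos h2 2) (by linarith [h.three_le, h.zero_lt])
  linarith

theorem indecomposable_of_form (h : FirstConjugates a t) (A B C u v w : ℤ) {α : Fin 3 → ℝ}
    (hα : ∀ i, α i = u + v * t i + w * t i ^ 2)
    (hα0 : α 0 * (A * (t 1 * t 2) - B * (t 1 + t 2) + C) < 0)
    (hα1 : 0 < α 1 * (A * (t 0 * t 2) - B * (t 0 + t 2) + C))
    (hα2 : 0 < α 2 * (A * (t 0 * t 1) - B * (t 0 + t 1) + C))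
    (hL : A * u + B * v + C * w = 1) :
    IndecomposableCoord (Algebra.adjoin ℤ {t}) 0 (α 0) := by
  obtain ⟨h1, -, -, -, h2, h3, h4, -, h5⟩ := id h
  refine ⟨α, signIndecomposable_of_form h.cube_eq ?_ ?_ ?_ A B C u v w hα hα0 hα1 hα2 hL, rfl⟩
  · exact mul_pos_of_neg_of_neg (by linarith) (by linarith)
  · exact mul_neg_of_pos_of_neg (by linarith) (by linarith)
  · exact mul_pos (by linarith) (by linarith)

theorem indecomposable_one (h : FirstConjugates a t) :
    IndecomposableCoord (Algebra.adjoin ℤ {t}) 0 1 := by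
  obtain ⟨h1, -, -, -, h2, h3, h4, h5, h6⟩ := id h
  -- The form is `u + w`. The form `u` alone fails, since `t 0 * t 1 < 0` has the wrong sign at the
  -- third root.
  refine h.indecomposable_of_form 1 0 1 1 0 0 (α := fun _ => 1) (fun i => by simp) ?_ ?_ ?_ rfl
  · simp only [Int.cast_one, Int.cast_zero]
    nlinarith
  · simp only [Int.cast_one, Int.cast_zero]
    nlinarith [mul_pos h2 (show 0 < t 2 by linarith)]
  · simp only [Int.cast_one, Int.cast_zero]
    nlinarith

/-- The quadratic elements with constant term `1` and signs `+`, `+`, `-`. -/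
theorem indecomposable_of_signs (h : FirstConjugates a t) (v w : ℤ)
    (h0 : 0 < 1 + v * t 0 + w * t 0 ^ 2) (h1 : 0 < 1 + v * t 1 + w * t 1 ^ 2)
    (h2 : 1 + v * t 2 + w * t 2 ^ 2 < 0) :
    IndecomposableCoord (Algebra.adjoin ℤ {t}) 0 (1 + v * t 0 + w * t 0 ^ 2) := by
  obtain ⟨g1, -, -, -, g2, g3, g4, -, g5⟩ := id h
  have p2 : 0 < t 2 := by linarith
  have p1 : t 1 < 0 := by linarith
  refine h.indecomposable_of_form 1 0 0 1 v w (α := fun i => 1 + v * t i + w * t i ^ 2)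
    (fun i => by simp) ?_ ?_ ?_ (by ring)
  · simpa using mul_neg_of_pos_of_neg h0 (mul_neg_of_neg_of_pos p1 p2)
  · simpa using mul_pos h1 (mul_pos g2 p2)
  · simpa using mul_pos_of_neg_of_neg h2 (mul_neg_of_pos_of_neg g2 p1)

theorem indecomposable_one_sub_mul (h : FirstConjugates a t) {j : ℕ} (hj : j < a) :
    IndecomposableCoord (Algebra.adjoin ℤ {t}) 0 (1 - j * t 0) := by
  rcases Nat.eq_zero_or_pos j with rfl | hj0
  · simpa using h.indecomposable_one
  have hj1 : (1 : ℝ) ≤ j := by exact_mod_cast hj0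
  have hja : (j : ℝ) ≤ a := by exact_mod_cast hj.le
  have := h.indecomposable_of_signs (-j) 0
    (by push_cast; nlinarith [h.mul_lt_one, h.zero_pos])
    (by push_cast; nlinarith [h.one_lt])
    (by push_cast; nlinarith [h.lt_two, h.three_le])
  convert this using 1
  push_cast
  ring

/-- For `j = 1`, positivity at `t 1` requires `|t 1|` to be below the golden ratio; the bound `-(3 /
2) < t 1` provides this. -/
theorem indecomposable_one_sub_mul_sub_sq (h : FirstConjugates a t) {j : ℕ} (hj0 : 1 ≤ j)
    (hj : j < a) : IndecomposableCoord (Algebra.adjoin ℤ {t}) 0 (1 - t 0 ^ 2 - j * t 0) := by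
  have hj1 : (1 : ℝ) ≤ j := by exact_mod_cast hj0
  have hja : (j : ℝ) ≤ a - 1 := by
    rw [le_sub_iff_add_le]; exact_mod_cast hj
  have := h.indecomposable_of_signs (-j) (-1)
    (by push_cast; nlinarith [h.mul_lt_one, h.zero_pos, h.zero_lt])
    (by push_cast; nlinarith [h.one_lt, h.lt_one])
    (by push_cast; nlinarith [h.lt_two, h.three_le])
  convert this using 1
  push_cast
  ring

/-- The signs are `+, +, -`. As the conjugates have sum `a - 1`, the form `-v - (a - 1) w` has the
interpolation factors `hᵢ = -tᵢ`, whose signs fit. -/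
theorem indecomposable_natCast_sub (h : FirstConjugates a t) {n : ℕ} (hn0 : 1 ≤ n) (hn : n < a) :
    IndecomposableCoord (Algebra.adjoin ℤ {t}) 0 (n - t 0) := by
  have hn1 : (1 : ℝ) ≤ n := by exact_mod_cast hn0
  have hna : (n : ℝ) ≤ a - 1 := by
    rw [le_sub_iff_add_le]; exact_mod_cast hn
  obtain ⟨g1, -, gs, -, g2, g3, g4, -, g5⟩ := id h
  have e0 : ((0 : ℤ) : ℝ) * (t 1 * t 2) - (-1 : ℤ) * (t 1 + t 2) + (1 - a : ℤ) = -t 0 := by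
    push_cast; linear_combination gs
  have e1 : ((0 : ℤ) : ℝ) * (t 0 * t 2) - (-1 : ℤ) * (t 0 + t 2) + (1 - a : ℤ) = -t 1 := by
    push_cast; linear_combination gs
  have e2 : ((0 : ℤ) : ℝ) * (t 0 * t 1) - (-1 : ℤ) * (t 0 + t 1) + (1 - a : ℤ) = -t 2 := by
    push_cast; linear_combination gs
  refine h.indecomposable_of_form 0 (-1) (1 - a) n (-1) 0 (α := fun i => n - t i)
    (fun i => by push_cast; ring) ?_ ?_ ?_ (by ring)
  · rw [e0]; exact mul_neg_of_pos_of_neg (by linarith) (by linarith)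
  · rw [e1]; exact mul_pos (by linarith) (by linarith)
  · rw [e2]; exact mul_pos_of_neg_of_neg (by linarith) (by linarith)

theorem unitCoord (h : FirstConjugates a t) : UnitCoord (Algebra.adjoin ℤ {t}) 0 (t 0) := by
  have ht := Algebra.self_mem_adjoin_singleton ℤ t
  refine ⟨t, ht, (1 + t) * ((a : ℕ) - t), mul_mem (add_mem (one_mem _) ht)
    (sub_mem (natCast_mem _ a) ht), ?_, rfl⟩
  funext i
  simpa [mul_assoc] using h.root i

theorem unitCoord_one_add (h : FirstConjugates a t) :
    UnitCoord (Algebra.adjoin ℤ {t}) 0 (1 + t 0) := by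
  have ht := Algebra.self_mem_adjoin_singleton ℤ t
  refine ⟨1 + t, add_mem (one_mem _) ht, t * ((a : ℕ) - t), mul_mem ht
    (sub_mem (natCast_mem _ a) ht), ?_, rfl⟩
  funext i
  have := h.root i
  simp only [Pi.mul_apply, Pi.add_apply, Pi.sub_apply, Pi.natCast_apply, Pi.one_apply]
  linear_combination this

theorem semiconvergents (h : FirstConjugates a t) :
    ∀ δ ∈ jpaSemiconvergents ![1, t 0, t 0 ^ 2],
      IndecomposableCoord (Algebra.adjoin ℤ {t}) 0 δ := by
  have three_le : 3 ≤ a := by exact_mod_cast h.three_le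
  have lin := @indecomposable_one_sub_mul _ _ h
  have one := h.indecomposable_one
  have cst := @indecomposable_natCast_sub _ _ h
  have quad := @indecomposable_one_sub_mul_sub_sq _ _ h
  have ut := h.unitCoord
  have us := h.unitCoord_one_add
  have e1 := h.one_sub_mul
  have ha := h.three_le
  have hat := h.mul_lt_one
  have h0 := h.zero_pos
  have h1 := h.zero_lt
  set P := IndecomposableCoord (Algebra.adjoin ℤ {t}) 0 with hPdef
  generalize t 0 = x at *
  have hP1 : ∀ s, P s → P (1 * s) := fun s hs => hs.unit_mul .one
  have hPx : ∀ s, P s → P (x * s) := fun s hs => hs.unit_mul ut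
  have hPi : ∀ s, P s → P ((1 + x)⁻¹ * s) := fun s hs => hs.unit_mul us.inv
  have e2 : x * (a - x) = (1 + x)⁻¹ :=
    eq_inv_of_mul_eq_one_left (by linear_combination -e1)
  have hi : (1 + x)⁻¹ < 1 := inv_lt_one_of_one_lt₀ (by linarith)
  have c1 : ((a - 1 : ℕ) : ℝ) = a - 1 := by rw [Nat.cast_sub (by omega)]; simp
  have c2 : ((a - 2 : ℕ) : ℝ) = a - 2 := by rw [Nat.cast_sub (by omega)]; simp
  have c3 : ((a - 3 : ℕ) : ℝ) = a - 3 := by rw [Nat.cast_sub (by omega)]; simp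
  have noy : ∀ {y z : ℝ}, ∀ j < 0, P (y - (j : ℕ) * z) := fun j hj => absurd hj (Nat.not_lt_zero j)
  have onez : ∀ {y z : ℝ}, P y → ∀ j < 1, P (y - (j : ℕ) * z) := fun hy j hj => by
    obtain rfl : j = 0 := by omega
    simpa using hy
  have fam : ∀ {y z c : ℝ} (q : ℕ), (∀ s, P s → P (c * s)) → q < a →
      y = c * (q - x) → z = c → ∀ j < q, P (y - (j : ℕ) * z) := by
    intro y z c q hc hqa hy hz j hj
    have hjq : ((q - j : ℕ) : ℝ) = q - j := by rw [Nat.cast_sub (by omega)]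
    convert hc _ (cst (n := q - j) (by omega) (by omega)) using 1
    rw [hy, hz, hjq]
    ring
  have linx : ∀ j < a, P (1 - (j : ℕ) * x) := fun j hj => lin hj
  -- The vector recurs after seven steps, up to the unit `x³ / (1 + x)`. Each step is deduced from
  -- its successor, so `s1` is the end of the period and `s7` its start.
  have loop : ∀ n, SemiconvergentsBefore P n ![1 - x, x * (a - 1 - x), 1] := by
    intro n
    induction n with
    | zero => exact fun k hk => absurd hk (Nat.not_lt_zero k)
    | succ n ih =>
      have s1 : SemiconvergentsBefore P (n + 1) ![x, x * (a - 2 - x), 1] := by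
        refine ih.step (a - 3) a h0 hPx (by ring) (by rw [c3]; ring) (by linear_combination e1)
          (by linarith) (by linarith) (by nlinarith) (by nlinarith) ?_ linx
        exact fun j hj => fam (a - 2) hPx (by omega) (by rw [c2]) rfl j (by omega)
      have s2 : SemiconvergentsBefore P (n + 2) ![x, x ^ 2, 1 - x ^ 2] := by
        refine s1.step 0 a h0 hPx (by ring) (by push_cast; ring) (by linear_combination e1)
          (by linarith) (by linarith) (by nlinarith) (by nlinarith) noy ?_
        intro j hj
        -- For `j = 0` the element `1 - t²` is negative at `t 1 < -1`, so its signs are not those of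
        -- `quad`; it is the unit `1 + t` times `1 - t`.
        rcases Nat.eq_zero_or_pos j with rfl | hj0
        · convert (cst (n := 1) le_rfl (by omega)).unit_mul us using 1
          push_cast
          ring
        · exact quad hj0 hj
      have s3 : SemiconvergentsBefore P (n + 3) ![1 - x ^ 2, x, 1] := by
        refine s2.step 0 1 one_pos hP1 (by ring) (by push_cast; ring) (by push_cast; ring)
          (by linarith) (by nlinarith) (by nlinarith) (by nlinarith) noy (onez one)
      have s4 : SemiconvergentsBefore P (n + 4) ![1, 1 - x ^ 2, 1 + x] := by
        refine s3.step 0 1 one_pos hP1 (by ring) (by push_cast; ring) (by push_cast; ring)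
          (by nlinarith) (by nlinarith) (by nlinarith) (by nlinarith) noy (onez (one.of_one us))
      have s5 : SemiconvergentsBefore P (n + 5) ![1, x * (a - x), a - 1 - x] := by
        have hs : 1 + x ≠ 0 := by linarith
        refine s4.step 0 (a - 2) (inv_pos.2 (by linarith : 0 < 1 + x)) hPi (by field_simp)
          (by rw [← e2]; push_cast; ring) ?_
          (by linarith) (by linarith) (by nlinarith) (by nlinarith) noy ?_
        · rw [c2]; field_simp; ring
        · exact fun j hj => fam (a - 1) hP1 (by omega) (by rw [c1]; ring) rfl j (by omega)
      have s6 : SemiconvergentsBefore P (n + 6) ![x * (a - 1 - x), x, 1 - x] := by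
        refine s5.step 0 1 h0 hPx (by ring) (by push_cast; ring) (by linear_combination e1)
          (by linarith) (by linarith) (by rw [e2]; positivity) (by rw [e2]; linarith) noy
          (onez ?_)
        simpa using cst (n := 1) le_rfl (by omega)
      have s7 : SemiconvergentsBefore P (n + 7) ![1 - x, x * (a - 1 - x), 1] := by
        refine s6.step 0 1 one_pos hP1 (by ring) (by push_cast; ring) (by push_cast; ring)
          (by nlinarith) (by nlinarith) (by linarith) (by linarith) noy (onez one)
      exact s7.mono (by omega)
  apply forall_semiconvergents
  intro n
  -- The preperiod has three steps, again treated from the last to the first.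
  have s1 : SemiconvergentsBefore P (n + 1) ![x, x * (a - 1 - x), 1] := by
    refine (loop n).step (a - 2) a h0 hPx (by ring) (by rw [c2]; ring) (by linear_combination e1)
      (by linarith) (by linarith) (by nlinarith) (by nlinarith) ?_ linx
    exact fun j hj => fam (a - 1) hPx (by omega) (by rw [c1]) rfl j (by omega)
  have s2 : SemiconvergentsBefore P (n + 2) ![x, x ^ 2, 1] := by
    refine s1.step 0 a h0 hPx (by ring) (by push_cast; ring) (by linear_combination e1)
      (by linarith) (by linarith) (by nlinarith) (by nlinarith) noy linx
  have s3 : SemiconvergentsBefore P (n + 3) ![1, x, x ^ 2] := by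
    refine s2.step 0 0 one_pos hP1 (by ring) (by push_cast; ring) (by push_cast; ring)
      (by linarith) (by linarith) (by positivity) (by nlinarith) noy noy
  exact s3.mono (by omega)

end FirstConjugates

/-! ### The second family: `t (1 - t) (a + t) = 1` -/

/-- `t 0`, `t 1`, `t 2` are the solutions of `x (1 - x) (a + x) = 1`; the first one is close
to `0`, the second one is close to `1`, and the third one is close to `-a`. -/
structure SecondConjugates (a : ℕ) (t : Fin 3 → ℝ) : Prop where
  five_le : (5 : ℝ) ≤ a
  root : ∀ i, t i * (1 - t i) * (a + t i) = 1
  sum : t 0 + t 1 + t 2 = 1 - a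
  prod : t 0 * t 1 * t 2 = -1
  zero_pos : 0 < t 0
  zero_lt : t 0 < 7 / 25
  lt_one : 19 / 25 < t 1
  one_lt : t 1 < 1
  two_lt : t 2 < -a

namespace SecondConjugates

variable {a : ℕ} {t : Fin 3 → ℝ}

theorem cube_eq (h : SecondConjugates a t) :
    t ^ 3 = ((1 - a : ℤ) : Fin 3 → ℝ) * t ^ 2 + ((a : ℤ) : Fin 3 → ℝ) * t +
      ((-1 : ℤ) : Fin 3 → ℝ) := by
  funext i
  have := h.root i
  simp only [Pi.add_apply, Pi.mul_apply, Pi.pow_apply, Pi.intCast_apply]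
  push_cast
  linear_combination -this

theorem cube_one_sub_eq (h : SecondConjugates a t) :
    (1 - t) ^ 3 = ((a + 2 : ℤ) : Fin 3 → ℝ) * (1 - t) ^ 2 +
      ((-(a + 1) : ℤ) : Fin 3 → ℝ) * (1 - t) + ((1 : ℤ) : Fin 3 → ℝ) := by
  funext i
  have := h.root i
  simp only [Pi.add_apply, Pi.mul_apply, Pi.pow_apply, Pi.sub_apply, Pi.one_apply,
    Pi.intCast_apply]
  push_cast
  linear_combination this

theorem signs (h : SecondConjugates a t) : 0 < (t 1 - t 0) * (t 1 - t 2) ∧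
    (t 0 - t 1) * (t 0 - t 2) < 0 ∧ 0 < (t 2 - t 0) * (t 2 - t 1) := by
  obtain ⟨h1, -, -, -, h2, h3, h4, h5, h6⟩ := h
  exact ⟨mul_pos (by linarith) (by linarith), mul_neg_of_neg_of_pos (by linarith) (by linarith),
    mul_pos_of_neg_of_neg (by linarith) (by linarith)⟩

theorem indecomposable_of_form (h : SecondConjugates a t) (A B C u v w : ℤ) {α : Fin 3 → ℝ}
    (hα : ∀ i, α i = u + v * t i + w * t i ^ 2)
    (hα0 : α 0 * (A * (t 1 * t 2) - B * (t 1 + t 2) + C) < 0)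
    (hα1 : 0 < α 1 * (A * (t 0 * t 2) - B * (t 0 + t 2) + C))
    (hα2 : 0 < α 2 * (A * (t 0 * t 1) - B * (t 0 + t 1) + C))
    (hL : A * u + B * v + C * w = 1) (i : Fin 3) :
    IndecomposableCoord (Algebra.adjoin ℤ {t}) i (α i) :=
  ⟨α, signIndecomposable_of_form h.cube_eq h.signs.1 h.signs.2.1 h.signs.2.2 A B C u v w hα
    hα0 hα1 hα2 hL, rfl⟩

theorem indecomposable_of_form_one_sub (h : SecondConjugates a t) (A C u v w : ℤ)
    {α : Fin 3 → ℝ} (hα : ∀ i, α i = u + v * (1 - t i) + w * (1 - t i) ^ 2)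
    (hα0 : α 0 * (A * ((1 - t 1) * (1 - t 2)) + C) < 0)
    (hα1 : 0 < α 1 * (A * ((1 - t 0) * (1 - t 2)) + C))
    (hα2 : 0 < α 2 * (A * ((1 - t 0) * (1 - t 1)) + C))
    (hL : A * u + C * w = 1) (i : Fin 3) :
    IndecomposableCoord (Algebra.adjoin ℤ {t}) i (α i) := by
  obtain ⟨h1, h2, h3⟩ := h.signs
  have e : Algebra.adjoin ℤ {1 - t} = Algebra.adjoin ℤ {t} := adjoin_one_sub_eq t
  rw [← e]
  refine ⟨α, signIndecomposable_of_form h.cube_one_sub_eq ?_ ?_ ?_ A 0 C u v w hα ?_ ?_ ?_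
    (by linarith), rfl⟩ <;>
    simp only [Pi.sub_apply, Pi.one_apply, Int.cast_zero, zero_mul, sub_zero] <;> linarith

theorem indecomposable_one (h : SecondConjugates a t) (i : Fin 3) :
    IndecomposableCoord (Algebra.adjoin ℤ {t}) i 1 := by
  obtain ⟨h1, -, -, hp, h2, h3, h4, h5, h6⟩ := id h
  -- The form is `u + 2 w`. Here `u + w` would fail, because `t 0 * t 2 = -1 / t 1 < -1`.
  refine h.indecomposable_of_form 1 0 2 1 0 0 (α := fun _ => 1) (fun i => by simp) ?_ ?_ ?_ rfl i
  · simp only [Int.cast_one, Int.cast_zero, Int.cast_ofNat]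
    nlinarith
  · simp only [Int.cast_one, Int.cast_zero, Int.cast_ofNat]
    nlinarith
  · simp only [Int.cast_one, Int.cast_zero, Int.cast_ofNat]
    nlinarith

theorem unitCoord (h : SecondConjugates a t) (i : Fin 3) :
    UnitCoord (Algebra.adjoin ℤ {t}) i (t i) := by
  have ht := Algebra.self_mem_adjoin_singleton ℤ t
  refine ⟨t, ht, (1 - t) * ((a : ℕ) + t), mul_mem (sub_mem (one_mem _) ht)
    (add_mem (natCast_mem _ a) ht), ?_, rfl⟩
  funext i
  simpa [mul_assoc] using h.root i

theorem unitCoord_one_sub (h : SecondConjugates a t) (i : Fin 3) :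
    UnitCoord (Algebra.adjoin ℤ {t}) i (1 - t i) := by
  have ht := Algebra.self_mem_adjoin_singleton ℤ t
  refine ⟨1 - t, sub_mem (one_mem _) ht, t * ((a : ℕ) + t), mul_mem ht
    (add_mem (natCast_mem _ a) ht), ?_, rfl⟩
  funext i
  have := h.root i
  simp only [Pi.mul_apply, Pi.add_apply, Pi.sub_apply, Pi.natCast_apply, Pi.one_apply]
  linear_combination this

/-! ### Second family: the root close to `0` -/

theorem mul_le (h : SecondConjugates a t) : (a - 2) * t 0 ≤ 1 - t 0 * (9 / 10) := by
  obtain ⟨h1, hr, -, hp, h2, h3, h4, h5, h6⟩ := id h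
  have r0 := hr 0
  nlinarith [mul_pos h2 h2]

theorem mul_add_sq_lt (h : SecondConjugates a t) : (a - 2) * t 0 + (a - 2) * t 0 ^ 2 < 1 := by
  have r0 := h.root 0
  have h2 := h.zero_pos
  have h3 := h.zero_lt
  have e : (1 - t 0) * (1 - ((a - 2) * t 0 + (a - 2) * t 0 ^ 2)) =
      t 0 ^ 2 * (1 - 2 * t 0 - t 0 ^ 2) := by
    linear_combination -(1 + t 0) * r0
  have : 0 < t 0 ^ 2 * (1 - 2 * t 0 - t 0 ^ 2) := mul_pos (pow_pos h2 2) (by nlinarith)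
  rw [← e] at this
  have := pos_of_mul_pos_right this (by linarith)
  linarith

theorem indecomposable_one_sub_mul (h : SecondConjugates a t) {j : ℕ} (hj : j ≤ a - 2) :
    IndecomposableCoord (Algebra.adjoin ℤ {t}) 0 (1 - j * t 0) := by
  -- The signs are `+, -, +` only from `j = 2` on; `1` and the unit `1 - t` are totally positive.
  obtain rfl | rfl | hj2 : j = 0 ∨ j = 1 ∨ 2 ≤ j := by omega
  · simpa using h.indecomposable_one 0
  · simpa using (h.indecomposable_one 0).of_one (h.unitCoord_one_sub 0)
  have hj1 : (2 : ℝ) ≤ j := by exact_mod_cast hj2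
  have hja : (j : ℝ) ≤ a - 2 := by
    rw [le_sub_iff_add_le]; exact_mod_cast (by omega : j + 2 ≤ a)
  obtain ⟨h1, hr, -, hp, h2, h3, h4, h5, h6⟩ := id h
  have r0 := hr 0
  refine h.indecomposable_of_form 1 0 0 1 (-j) 0 (α := fun i => 1 - j * t i)
    (fun i => by push_cast; ring) ?_ ?_ ?_ (by ring) 0
  · have := h.mul_le
    have := mul_le_mul_of_nonneg_right hja h2.le
    have : 0 < 1 - j * t 0 := by linarith
    simpa using mul_neg_of_pos_of_neg this (by nlinarith : t 1 * t 2 < 0)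
  · simpa using mul_pos_of_neg_of_neg (by nlinarith : 1 - j * t 1 < 0)
      (by nlinarith : t 0 * t 2 < 0)
  · simpa using mul_pos (by nlinarith : 0 < 1 - j * t 2) (by nlinarith : 0 < t 0 * t 1)

theorem indecomposable_one_sub_mul_sub_mul_sq (h : SecondConjugates a t) {j : ℕ} (hj0 : 1 ≤ j)
    (hj : j < a - 2) :
    IndecomposableCoord (Algebra.adjoin ℤ {t}) 0 (1 - (a - 2) * t 0 - j * t 0 ^ 2) := by
  have hj1 : (1 : ℝ) ≤ j := by exact_mod_cast hj0
  have hja : (j : ℝ) ≤ a - 3 := by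
    rw [le_sub_iff_add_le]; exact_mod_cast (by omega : j + 3 ≤ a)
  obtain ⟨h1, hr, hs, hp, h2, h3, h4, h5, h6⟩ := id h
  have key : ∀ x y z : ℝ, x + y + z = 1 - a → x * (y * z) = -1 → x * (1 - x) * (a + x) = 1 →
      x < 1 → x ≠ 0 →
      ((a - 1 : ℤ) : ℝ) * (y * z) - ((1 : ℤ) : ℝ) * (y + z) + ((0 : ℤ) : ℝ) < 0 := by
    intro x y z hs hp hr hx hx0
    -- The factor `h` of the form `(a - 1) u + v` at a root `x` satisfies `x² h = x - 1`. All roots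
    -- are below `1`, so the form is positive on the signature `+, -, -`.
    have e : x ^ 2 * (((a - 1 : ℤ) : ℝ) * (y * z) - ((1 : ℤ) : ℝ) * (y + z) + ((0 : ℤ) : ℝ)) =
        x - 1 := by
      push_cast
      linear_combination (a - 1) * x * hp - x ^ 2 * hs - hr
    have hx2 : 0 < x ^ 2 := by positivity
    by_contra hcon
    have := mul_nonneg hx2.le (not_lt.1 hcon)
    linarith
  have k0 := key (t 0) (t 1) (t 2) hs (by linarith) (hr 0) (by linarith) (by linarith)
  have k1 := key (t 1) (t 0) (t 2) (by linarith) (by linarith) (hr 1) h5 (by linarith)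
  have k2 := key (t 2) (t 0) (t 1) (by linarith) (by linarith) (hr 2) (by linarith) (by linarith)
  refine h.indecomposable_of_form (a - 1) 1 0 1 (-(a - 2)) (-j)
    (α := fun i => 1 - (a - 2) * t i - j * t i ^ 2) (fun i => by push_cast; ring) ?_ ?_ ?_
    (by ring) 0
  · refine mul_neg_of_pos_of_neg ?_ k0
    have := h.mul_add_sq_lt
    have h7 : j * t 0 ^ 2 ≤ (a - 2) * t 0 ^ 2 :=
      mul_le_mul_of_nonneg_right (by linarith) (sq_nonneg _)
    linarith
  · exact mul_pos_of_neg_of_neg (by nlinarith) k1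
  · exact mul_pos_of_neg_of_neg (by nlinarith) k2

theorem indecomposable_one_sub_mul_sub_sq (h : SecondConjugates a t) {j : ℕ} (hj0 : 2 ≤ j)
    (hj : j < a - 2) :
    IndecomposableCoord (Algebra.adjoin ℤ {t}) 0 (1 - j * t 0 - t 0 ^ 2) := by
  have hj1 : (2 : ℝ) ≤ j := by exact_mod_cast hj0
  have hja : (j : ℝ) ≤ a - 3 := by
    rw [le_sub_iff_add_le]; exact_mod_cast (by omega : j + 3 ≤ a)
  obtain ⟨h1, hr, hs, hp, h2, h3, h4, h5, h6⟩ := id h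
  have := h.mul_le
  refine h.indecomposable_of_form 0 0 (-1) 1 (-j) (-1)
    (α := fun i => 1 - j * t i - t i ^ 2) (fun i => by push_cast; ring) ?_ ?_ ?_
    (by ring) 0 <;> push_cast <;> nlinarith

/-- The forms `u + v - w` and `u + v - 2 w` are both positive on the signature of `1 + t` and take
the value `2` there. Each summand therefore has both values equal to `1`, so it is `u + (1 - u) t`;
the signs at `t 2` of this and of its complement exclude every integer `u`. -/
theorem indecomposable_one_add (h : SecondConjugates a t) :
    IndecomposableCoord (Algebra.adjoin ℤ {t}) 0 (1 + t 0) := by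
  obtain ⟨h1, hr, hs, hp, h2, h3, h4, h5, h6⟩ := id h
  have d0 : 0 < 1 + t 0 := by linarith
  have d1 : 0 < 1 + t 1 := by linarith
  have d2 : 1 + t 2 < 0 := by linarith
  have key : ∀ C : ℝ, C = -1 ∨ C = -2 → ∀ u v w : ℤ,
      (∀ i, 0 < (1 + t i) * (u + v * t i + w * t i ^ 2)) → 0 < 1 * u + 1 * v + C * (w : ℝ) := by
    intro C hC u v w hβ
    have hC1 : C ≤ -1 := by rcases hC with rfl | rfl <;> norm_num
    have hC2 : -2 ≤ C := by rcases hC with rfl | rfl <;> norm_num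
    refine form_pos h.signs.1 h.signs.2.1 h.signs.2.2 (α := fun i => 1 + t i) ?_ ?_ ?_
      (hβ 0) (hβ 1) (hβ 2)
    · refine mul_neg_of_pos_of_neg d0 ?_
      have r0 := hr 0
      have : t 0 * (1 * (t 1 * t 2) - 1 * (t 1 + t 2) + C) ≤
          t 0 * (t 0 + a - 2) - 1 := by nlinarith
      nlinarith [h.mul_le]
    · refine mul_pos d1 ?_
      nlinarith
    · refine mul_pos_of_neg_of_neg d2 ?_
      nlinarith
  have ht := Algebra.self_mem_adjoin_singleton ℤ t
  refine ⟨1 + t, ⟨add_mem (one_mem _) ht, ?_, ?_⟩, rfl⟩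
  · intro i
    fin_cases i
    exacts [d0.ne', d1.ne', d2.ne]
  · intro β hβ γ hγ hb hc heq
    obtain ⟨u, v, w, rfl⟩ := exists_coords_of_mem_adjoin h.cube_eq hβ
    have hγ' : ∀ i, γ i = (1 - u : ℤ) + (1 - v : ℤ) * t i + (-w : ℤ) * t i ^ 2 := by
      intro i
      have h2 := congrFun heq i
      simp only [Pi.add_apply, Pi.mul_apply, Pi.intCast_apply, Pi.pow_apply, Pi.one_apply] at h2
      push_cast
      linear_combination -h2
    have hb' : ∀ i, 0 < (1 + t i) * (u + v * t i + w * t i ^ 2) := hb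
    have hc' : ∀ i, 0 < (1 + t i) * ((1 - u : ℤ) + (1 - v : ℤ) * t i + (-w : ℤ) * t i ^ 2) :=
      fun i => by rw [← hγ']; exact hc i
    have l1 := key _ (.inl rfl) u v w hb'
    have l2 := key _ (.inr rfl) u v w hb'
    have l3 := key _ (.inl rfl) _ _ _ hc'
    have l4 := key _ (.inr rfl) _ _ _ hc'
    obtain rfl : w = 0 := by
      norm_cast at l1 l2 l3 l4
      omega
    obtain rfl : v = 1 - u := by
      norm_cast at l1 l3
      omega
    have b2 := hb' 2
    have c2 := hc' 2
    push_cast at b2 c2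
    rcases le_or_gt u 0 with hu | hu
    · have : (u : ℝ) ≤ 0 := by exact_mod_cast hu
      nlinarith
    · have : (1 : ℝ) ≤ u := by exact_mod_cast hu
      nlinarith

theorem semiconvergents_zero (h : SecondConjugates a t) :
    ∀ δ ∈ jpaSemiconvergents ![1, t 0, t 0 ^ 2],
      IndecomposableCoord (Algebra.adjoin ℤ {t}) 0 δ := by
  have five_le : 5 ≤ a := by exact_mod_cast h.five_le
  have lin := @indecomposable_one_sub_mul _ _ h
  have one := h.indecomposable_one 0
  have quad := @indecomposable_one_sub_mul_sub_mul_sq _ _ h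
  have quad' := @indecomposable_one_sub_mul_sub_sq _ _ h
  have add := h.indecomposable_one_add
  have ut := h.unitCoord 0
  have us := h.unitCoord_one_sub 0
  have r0 := h.root 0
  have ha := h.five_le
  have h0 := h.zero_pos
  have h1 := h.zero_lt
  set P := IndecomposableCoord (Algebra.adjoin ℤ {t}) 0 with hPdef
  generalize t 0 = x at *
  have hP1 : ∀ s, P s → P (1 * s) := fun s hs => hs.unit_mul .one
  have hPx : ∀ s, P s → P (x * s) := fun s hs => hs.unit_mul ut
  obtain ⟨c, hc⟩ : ∃ c, c = x ^ 2 * (1 - x)⁻¹ := ⟨_, rfl⟩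
  have hPc : ∀ s, P s → P (c * s) := fun s hs => by
    rw [hc, sq]
    exact hs.unit_mul ((ut.mul ut).mul us.inv)
  have hx1 : 1 - x ≠ 0 := by linarith
  have hcx : c * (1 - x) = x ^ 2 := by rw [hc]; field_simp
  have hc0 : 0 < c := by
    have : 0 < 1 - x := by linarith
    rw [hc]; positivity
  have hc1 : c < 1 / 2 * x := by nlinarith
  -- Eliminating `a x` and `a x²` makes the inequalities for the partial quotients linear in `x`,
  -- `x²`, `c x`, `c x²`.
  have hax : a * x = 1 + x + c * x := by
    refine mul_left_cancel₀ hx1 ?_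
    linear_combination r0 - x * hcx
  have hax2 : a * x ^ 2 = x + x ^ 2 + c * x ^ 2 := by linear_combination x * hax
  have b1 : 0 < x ^ 2 := by positivity
  have b2 : x ^ 2 < 7 / 25 * x := by nlinarith
  have b3 : 0 < c * x := by positivity
  have b4 : c * x < 1 / 2 * x ^ 2 := by nlinarith
  have b5 : 0 < c * x ^ 2 := by positivity
  have b6 : c * x ^ 2 < 7 / 50 * x ^ 2 := by nlinarith
  have c2 : ((a - 2 : ℕ) : ℝ) = a - 2 := by rw [Nat.cast_sub (by omega)]; simp
  have c3 : ((a - 3 : ℕ) : ℝ) = a - 3 := by rw [Nat.cast_sub (by omega)]; simp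
  have c4 : ((a - 4 : ℕ) : ℝ) = a - 4 := by rw [Nat.cast_sub (by omega)]; simp
  have noy : ∀ {y z : ℝ}, ∀ j < 0, P (y - (j : ℕ) * z) := fun j hj => absurd hj (Nat.not_lt_zero j)
  have onez : ∀ {y z : ℝ}, P y → ∀ j < 1, P (y - (j : ℕ) * z) := fun hy j hj => by
    obtain rfl : j = 0 := by omega
    simpa using hy
  have linx : ∀ j < a - 2, P (x - (j : ℕ) * x ^ 2) := fun j hj => by
    convert hPx _ (lin (j := j) hj.le) using 1
    ring
  -- The period has three steps and the unit factor `c = x² / (1 - x)`; `s3` is its first vector.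
  have loop : ∀ n, SemiconvergentsBefore P n
      ![1 - (a - 2) * x - (a - 2) * x ^ 2, x - (a - 2) * x ^ 2, x ^ 2] := by
    intro n
    induction n with
    | zero => exact fun k hk => absurd hk (Nat.not_lt_zero k)
    | succ n ih =>
      have s1 : SemiconvergentsBefore P (n + 1) ![x ^ 2, 1 - (a - 2) * x - x ^ 2, x] := by
        refine ih.step (a - 3) (a - 2) one_pos hP1 (by ring) (by rw [c3]; ring)
          (by rw [c2]; ring) (by linarith) (by linarith) (by linarith) (by linarith) ?_ linx
        intro j hj
        convert quad (j := j + 1) (by omega) (by omega) using 1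
        push_cast
        ring
      have s2 : SemiconvergentsBefore P (n + 2) ![x, x * (1 + x), 1 - 2 * x - x ^ 2] := by
        refine s1.step 1 (a - 4) one_pos hP1 (by ring) (by push_cast; ring)
          (by rw [c4]; ring) (by linarith) (by linarith) (by linarith) (by linarith)
          (onez (hPx _ add)) ?_
        intro j hj
        convert quad' (j := j + 2) (by omega) (by omega) using 1
        push_cast
        ring
      have s3 : SemiconvergentsBefore P (n + 3)
          ![1 - (a - 2) * x - (a - 2) * x ^ 2, x - (a - 2) * x ^ 2, x ^ 2] := by
        refine s2.step 1 1 hc0 hPc ?_ ?_ ?_ (by linarith) (by linarith) (by linarith)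
          (by linarith) (onez ?_) (onez ?_)
        · refine mul_left_cancel₀ hx1 ?_
          linear_combination (-(1 - 2 * x - x ^ 2)) * hcx - (1 + x) * r0
        · refine mul_left_cancel₀ hx1 ?_
          push_cast
          linear_combination (-x) * hcx + r0
        · refine mul_left_cancel₀ hx1 ?_
          push_cast
          linear_combination (-(x * (1 + x))) * hcx + (1 + x) * r0
        · convert hPx _ (lin (j := a - 2) le_rfl) using 1
          rw [c2]
          ring
        · simpa [sq] using hPx _ (hPx _ one)
      exact s3.mono (by omega)
  apply forall_semiconvergents
  intro n
  have s1 : SemiconvergentsBefore P (n + 1) ![x ^ 2, 1 - (a - 2) * x, x] := by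
    refine (loop n).step (a - 2) (a - 2) one_pos hP1 (by ring) (by rw [c2]; ring)
      (by rw [c2]; ring) (by linarith) (by linarith) (by linarith) (by linarith) ?_ linx
    intro j hj
    rcases Nat.eq_zero_or_pos j with rfl | hj0
    · convert lin (j := a - 2) le_rfl using 1
      rw [c2]
      simp
    · exact quad hj0 hj
  have s2 : SemiconvergentsBefore P (n + 2) ![x, x ^ 2, 1] := by
    refine s1.step 0 (a - 2) one_pos hP1 (by ring) (by push_cast; ring) (by rw [c2]; ring)
      (by positivity) (by linarith) (by linarith) (by linarith) noy (fun j hj => lin hj.le)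
  have s3 : SemiconvergentsBefore P (n + 3) ![1, x, x ^ 2] := by
    refine s2.step 0 0 one_pos hP1 (by ring) (by push_cast; ring) (by push_cast; ring)
      (by linarith) (by linarith) (by positivity) (by linarith) noy noy
  exact s3.mono (by omega)

/-! ### Second family: the root close to `1`, expanded in `1 - t 1` -/

theorem one_sub_mul_pos (h : SecondConjugates a t) :
    0 < 1 - 2 * (1 - t 1) - (a - 2) * ((1 - t 1) * t 1) := by
  have r := h.root 1
  have h1 := h.lt_one
  have h2 := h.one_lt
  have e : 1 - 2 * (1 - t 1) - (a - 2) * ((1 - t 1) * t 1) =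
      (1 - t 1) * (1 - 4 * (1 - t 1) + (1 - t 1) ^ 2) := by
    linear_combination -r
  rw [e]
  -- With `y = 1 - t 1`, positivity of `1 - 4 y + y²` needs `y < 2 - √3`; `y < 6 / 25` suffices.
  exact mul_pos (by linarith) (by nlinarith)

theorem mul_one_sub_lt (h : SecondConjugates a t) : (a - 2) * (1 - t 1) < 1 := by
  have r := h.root 1
  have h1 := h.lt_one
  have h2 := h.one_lt
  have e : t 1 * (1 - (a - 2) * (1 - t 1)) = (1 - t 1) * (t 1 ^ 2 + 2 * t 1 - 1) := by
    linear_combination -r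
  have : 0 < (1 - t 1) * (t 1 ^ 2 + 2 * t 1 - 1) :=
    mul_pos (by linarith) (by nlinarith)
  rw [← e] at this
  have := pos_of_mul_pos_right this (by linarith)
  linarith

end SecondConjugates

namespace SecondConjugates

variable {a : ℕ} {t : Fin 3 → ℝ}

theorem indecomposable_one_sub_mul_one_sub (h : SecondConjugates a t) {j : ℕ} (hj : j ≤ a - 2) :
    IndecomposableCoord (Algebra.adjoin ℤ {t}) 1 (1 - j * (1 - t 1)) := by
  obtain rfl | rfl | hj2 : j = 0 ∨ j = 1 ∨ 2 ≤ j := by omega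
  · simpa using h.indecomposable_one 1
  · simpa using (h.indecomposable_one 1).of_one (h.unitCoord 1)
  have hj1 : (2 : ℝ) ≤ j := by exact_mod_cast hj2
  have hja : (j : ℝ) ≤ a - 2 := by
    rw [le_sub_iff_add_le]
    have := h.five_le
    have : 5 ≤ a := by exact_mod_cast this
    exact_mod_cast (by omega : j + 2 ≤ a)
  have hlt := h.mul_one_sub_lt
  have r0 := h.root 0
  obtain ⟨h1, -, hs, hp, h2, h3, h4, h5, h6⟩ := id h
  have pu : (1 - t 0) * (1 - t 1) * (1 - t 2) = 1 := by
    refine mul_left_cancel₀ h2.ne' ?_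
    linear_combination r0 - t 0 * (1 - t 0) * hs + (1 - t 0) * hp
  -- The signs are `-, +, -`. The numbers `1 - tᵢ` have product `1`, so the factors of the form `u -
  -- w` are `1 / (1 - tᵢ) - 1`, positive at `t 0` and `t 1` and negative at `t 2`.
  refine h.indecomposable_of_form_one_sub 1 (-1) 1 (-j) 0 (α := fun i => 1 - j * (1 - t i))
    (fun i => by push_cast; ring) ?_ ?_ ?_ (by ring) 1
  · exact mul_neg_of_neg_of_pos (by nlinarith) (by push_cast; nlinarith)
  · exact mul_pos (by nlinarith) (by push_cast; nlinarith)
  · exact mul_pos_of_neg_of_neg (by nlinarith) (by push_cast; nlinarith)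

theorem indecomposable_one_sub_mul_add_sq (h : SecondConjugates a t) {n : ℕ} (hn0 : 2 ≤ n)
    (hn : n ≤ a - 2) :
    IndecomposableCoord (Algebra.adjoin ℤ {t}) 1 (1 - n * (1 - t 1) + (1 - t 1) ^ 2) := by
  obtain rfl | hn3 : n = 2 ∨ 3 ≤ n := by omega
  · convert (h.indecomposable_one 1).of_one ((h.unitCoord 1).mul (h.unitCoord 1)) using 1
    push_cast
    ring
  have hn1 : (3 : ℝ) ≤ n := by exact_mod_cast hn3
  have hna : (n : ℝ) ≤ a - 2 := by
    rw [le_sub_iff_add_le]; exact_mod_cast (by omega : n + 2 ≤ a)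
  have hlt := h.mul_one_sub_lt
  obtain ⟨h1, -, hs, hp, h2, h3, h4, h5, h6⟩ := id h
  refine h.indecomposable_of_form_one_sub 0 1 1 (-n) 1
    (α := fun i => 1 - n * (1 - t i) + (1 - t i) ^ 2)
    (fun i => by push_cast; ring) ?_ ?_ ?_ (by ring) 1 <;> push_cast <;> nlinarith

theorem indecomposable_one_sub_mul_sub_mul (h : SecondConjugates a t) {j : ℕ} (hj : j < a - 2) :
    IndecomposableCoord (Algebra.adjoin ℤ {t}) 1
      (1 - 2 * (1 - t 1) - j * ((1 - t 1) * t 1)) := by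
  -- From `j = 1` on the signs are `-, +, +`; for `j = 0` the value at `t 2` is negative.
  rcases Nat.eq_zero_or_pos j with rfl | hj0
  · have := h.five_le
    have : 5 ≤ a := by exact_mod_cast this
    simpa using h.indecomposable_one_sub_mul_one_sub (j := 2) (by omega)
  have hj1 : (1 : ℝ) ≤ j := by exact_mod_cast hj0
  have hja : (j : ℝ) ≤ a - 2 := by
    rw [le_sub_iff_add_le]; exact_mod_cast (by omega : j + 2 ≤ a)
  have hlt := h.one_sub_mul_pos
  obtain ⟨h1, -, hs, hp, h2, h3, h4, h5, h6⟩ := id h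
  refine h.indecomposable_of_form_one_sub 1 0 1 (-2 - j) j
    (α := fun i => 1 - 2 * (1 - t i) - j * ((1 - t i) * t i))
    (fun i => by push_cast; ring) ?_ ?_ ?_ (by ring) 1
  · refine mul_neg_of_neg_of_pos ?_ (by push_cast; nlinarith)
    have : 0 < (1 - t 0) * t 0 := mul_pos (by linarith) h2
    nlinarith
  · refine mul_pos ?_ (by push_cast; nlinarith)
    have : 0 ≤ (1 - t 1) * t 1 := mul_nonneg (by linarith) (by linarith)
    have := mul_le_mul_of_nonneg_right hja this
    linarith
  · refine mul_pos ?_ (by push_cast; nlinarith)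
    have : 0 < (1 - t 2) * -t 2 := mul_pos (by linarith) (by linarith)
    nlinarith [mul_nonneg (sub_nonneg.2 hj1) this.le]

theorem semiconvergents_one (h : SecondConjugates a t) :
    ∀ δ ∈ jpaSemiconvergents ![1, t 1, t 1 ^ 2],
      IndecomposableCoord (Algebra.adjoin ℤ {t}) 1 δ := by
  have five_le : 5 ≤ a := by exact_mod_cast h.five_le
  have lin := @indecomposable_one_sub_mul_one_sub _ _ h
  have one := h.indecomposable_one 1
  have quad := @indecomposable_one_sub_mul_add_sq _ _ h
  have mix := @indecomposable_one_sub_mul_sub_mul _ _ h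
  have us := h.unitCoord 1
  have uy := h.unitCoord_one_sub 1
  have r := h.root 1
  have ha := h.five_le
  have h0 := h.lt_one
  have h1 := h.one_lt
  set P := IndecomposableCoord (Algebra.adjoin ℤ {t}) 1 with hPdef
  obtain ⟨y, hy⟩ : ∃ y, t 1 = 1 - y := ⟨1 - t 1, by ring⟩
  simp only [hy, sub_sub_cancel] at lin quad mix us uy r h0 h1 ⊢
  replace h0 : y < 6 / 25 := by linarith
  replace h1 : 0 < y := by linarith
  have hP1 : ∀ s, P s → P (1 * s) := fun s hs => hs.unit_mul .one
  have hPy : ∀ s, P s → P (y * s) := fun s hs => hs.unit_mul uy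
  obtain ⟨d, hd⟩ : ∃ d, d = y * (1 - y)⁻¹ := ⟨_, rfl⟩
  have hPd : ∀ s, P s → P (d * s) := fun s hs => by
    rw [hd]
    exact hs.unit_mul (uy.mul us.inv)
  have hy1 : 1 - y ≠ 0 := by linarith
  have hdy : d * (1 - y) = y := by rw [hd]; field_simp
  have hd0 : y < d := by nlinarith
  have hd1 : d < 2 * y := by nlinarith
  have hay : a * y = 1 + d - y + y ^ 2 := by
    refine mul_left_cancel₀ hy1 ?_
    linear_combination r - hdy
  have b1 : 0 < y ^ 2 := by positivity
  have b2 : y ^ 2 < 6 / 25 * y := by nlinarith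
  have c2 : ((a - 2 : ℕ) : ℝ) = a - 2 := by rw [Nat.cast_sub (by omega)]; simp
  have c3 : ((a - 3 : ℕ) : ℝ) = a - 3 := by rw [Nat.cast_sub (by omega)]; simp
  have c4 : ((a - 4 : ℕ) : ℝ) = a - 4 := by rw [Nat.cast_sub (by omega)]; simp
  have c5 : ((a - 5 : ℕ) : ℝ) = a - 5 := by rw [Nat.cast_sub (by omega)]; simp
  have noy : ∀ {y z : ℝ}, ∀ j < 0, P (y - (j : ℕ) * z) := fun j hj => absurd hj (Nat.not_lt_zero j)
  have onez : ∀ {y z : ℝ}, P y → ∀ j < 1, P (y - (j : ℕ) * z) := fun hy j hj => by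
    obtain rfl : j = 0 := by omega
    simpa using hy
  have sq : ∀ {n : ℕ} {z : ℝ}, 2 ≤ n → n ≤ a - 2 → z = 1 - n * y + y ^ 2 → P z := by
    rintro n z h2 h3 rfl
    exact quad h2 h3
  have ps : P (1 - y) := one.of_one us
  -- The period has seven steps and the unit factor `d² y`; the preperiod below has four.
  have loop : ∀ n, SemiconvergentsBefore P n
      ![y * (1 - y), (1 - y) ^ 2 - (a - 3) * y, y] := by
    intro n
    induction n with
    | zero => exact fun k hk => absurd hk (Nat.not_lt_zero k)
    | succ n ih =>
      have s1 : SemiconvergentsBefore P (n + 1) ![y, y * (1 - y), 1 - 3 * y + y ^ 2] := by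
        refine ih.step 0 (a - 4) one_pos hP1 (by ring) (by push_cast; ring)
          (by rw [c4]; ring) (by linarith) (by linarith) (by linarith) (by linarith) noy ?_
        intro j hj
        exact sq (n := j + 3) (by omega) (by omega) (by push_cast; ring)
      have s2 : SemiconvergentsBefore P (n + 2) ![1 - 3 * y + y ^ 2, y, 1 - 2 * y] := by
        refine s1.step 0 1 one_pos hP1 (by ring) (by push_cast; ring)
          (by push_cast; ring) (by linarith) (by linarith) (by linarith) (by linarith) noy
          (onez ?_)
        simpa using lin (j := 2) (by omega)
      have s3 : SemiconvergentsBefore P (n + 3) ![1 - 2 * y, 1 - 3 * y + y ^ 2, 1 - y] := by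
        exact s2.step 0 1 one_pos hP1 (by ring) (by push_cast; ring)
          (by push_cast; ring) (by linarith) (by linarith) (by linarith) (by linarith) noy
          (onez ps)
      have s4 : SemiconvergentsBefore P (n + 4) ![y, 1 - 4 * y + y ^ 2, 1 - y] := by
        -- The quotient `a - 5` is nonnegative exactly when `a ≥ 5`.
        refine s3.step (a - 5) (a - 2) (by linarith) hPd (by linarith)
          (by rw [c5]; linear_combination -hay - 2 * hdy)
          (by rw [c2]; linear_combination -hay - (2 - y) * hdy)
          (by linarith) (by linarith) (by linarith) (by linarith) ?_ ?_
        · intro j hj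
          exact sq (n := j + 4) (by omega) (by omega) (by push_cast; ring)
        · intro j hj
          convert lin (j := j + 1) (by omega) using 1
          push_cast
          ring
      have s5 : SemiconvergentsBefore P (n + 5) ![y * (1 - y), y ^ 2, 1 - 2 * y] := by
        exact s4.step 0 (a - 2) h1 hPy (by ring) (by push_cast; ring)
          (by rw [c2]; linear_combination -r) (by linarith) (by linarith) (by linarith)
          (by linarith) noy (fun j hj => mix hj)
      have s6 : SemiconvergentsBefore P (n + 6) ![1 - 2 * y, y * (1 - y), (1 - y) ^ 2] := by
        exact s5.step 0 1 one_pos hP1 (by ring) (by push_cast; ring)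
          (by push_cast; ring) (by linarith) (by linarith) (by linarith) (by linarith) noy
          (onez (sq (n := 2) le_rfl (by omega) (by push_cast; ring)))
      have s7 : SemiconvergentsBefore P (n + 7)
          ![y * (1 - y), (1 - y) ^ 2 - (a - 3) * y, y] := by
        exact s6.step 0 1 (by linarith) hPd (by linear_combination (-(1 - y)) * hdy)
          (by push_cast; linear_combination -hay - 2 * hdy)
          (by push_cast; linear_combination -y * hdy)
          (by linarith) (by linarith) (by linarith) (by linarith) noy
          (onez (one.of_one uy))
      exact s7.mono (by omega)
  apply forall_semiconvergents
  intro n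
  have s1 : SemiconvergentsBefore P (n + 1) ![y, y * (1 - y), (1 - y) ^ 2] := by
    refine (loop n).step 0 (a - 3) one_pos hP1 (by ring) (by push_cast; ring)
      (by rw [c3]; ring) (by linarith) (by linarith) (by linarith) (by linarith) noy ?_
    intro j hj
    exact sq (n := j + 2) (by omega) (by omega) (by push_cast; ring)
  have s2 : SemiconvergentsBefore P (n + 2) ![(1 - y) ^ 2, y, 1 - y] := by
    exact s1.step 0 1 one_pos hP1 (by ring) (by push_cast; ring) (by push_cast; ring)
      (by linarith) (by linarith) (by linarith) (by linarith) noy (onez ps)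
  have s3 : SemiconvergentsBefore P (n + 3) ![1 - y, (1 - y) ^ 2, 1] := by
    exact s2.step 0 1 one_pos hP1 (by ring) (by push_cast; ring) (by push_cast; ring)
      (by linarith) (by linarith) (by linarith) (by linarith) noy (onez one)
  have s4 : SemiconvergentsBefore P (n + 4) ![1, 1 - y, (1 - y) ^ 2] := by
    exact s3.step 0 0 one_pos hP1 (by ring) (by push_cast; ring) (by push_cast; ring)
      (by linarith) (by linarith) (by linarith) (by linarith) noy noy
  exact s4.mono (by omega)

end SecondConjugates

/-! ### Location of the roots -/

theorem firstConjugates_of_roots {a : ℕ} (ha : 3 ≤ a) {ρ ρ' ρ'' : ℝ}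
    (h : AreEnnolaRootsFirst a ρ ρ' ρ'') : FirstConjugates a (-![ρ', ρ, ρ'']) := by
  obtain ⟨e0, e1, e2, h1, h2⟩ := h
  have ha' : (3 : ℝ) ≤ a := by exact_mod_cast ha
  obtain ⟨hs, -, hp⟩ := vieta_of_roots (b := a - 1) (c := -a) (d := -1) (x := ρ') (y := ρ)
    (z := ρ'') (by linarith) (by linarith) (by linarith) h2.ne (h1.trans h2).ne' h1.ne'
  have n2 : ρ'' < 0 := by linarith
  have n1 : ρ' < 0 := by
    by_contra hcon
    have := mul_nonneg (not_lt.1 hcon) ((not_lt.1 hcon).trans h2.le)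
    nlinarith
  have p0 : 0 < ρ := by
    by_contra hcon
    nlinarith [mul_pos (neg_pos.2 n1) (neg_pos.2 n2)]
  have g0 : 1 < ρ := by
    have : ρ * (ρ + a) * (ρ - 1) = 1 := by linear_combination e0
    by_contra hcon
    have := mul_nonneg (mul_nonneg p0.le (by linarith : 0 ≤ ρ + a)) (sub_nonneg.2 (not_lt.1 hcon))
    linarith
  have l0 : ρ < 3 / 2 := by
    by_contra hcon
    have := not_lt.1 hcon
    have h3 : ρ * (ρ - 1) * (ρ + a) = 1 := by linear_combination e0
    have h4 : 3 / 4 ≤ ρ * (ρ - 1) := by nlinarith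
    nlinarith
  -- The value of the cubic at `-1` is `2 a - 3 > 0`, so `-1` separates `ρ''` from `ρ'`.
  have hm : (1 + ρ') * (1 + ρ'') < 0 := by
    have : (1 + ρ) * ((1 + ρ') * (1 + ρ'')) = -(2 * a - 3) := by
      refine mul_left_cancel₀ p0.ne' ?_
      linear_combination (ρ * (1 + ρ)) * hs + (1 + ρ) * hp - e0
    by_contra hcon
    have := mul_nonneg (by linarith : 0 ≤ 1 + ρ) (not_lt.1 hcon)
    linarith
  have m1 : -1 < ρ' := by
    by_contra hcon
    nlinarith
  have m2 : ρ'' < -1 := by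
    by_contra hcon
    nlinarith
  refine ⟨ha', ?_, ?_, ?_, ?_, ?_, ?_, ?_, ?_⟩
  · intro i
    fin_cases i <;> simp <;> linarith
  · simp; linarith
  · simp; linarith
  · simpa using n1
  · by_contra hcon
    have h5 : ρ' ≤ -(3 / 10) := by
      have := not_lt.1 hcon
      simp at this
      linarith
    -- With `s = -ρ'`, already `s (1 + s) (3 - s) > 1` for `3 / 10 ≤ s ≤ 1`.
    nlinarith [mul_nonneg (by linarith : 0 ≤ -(3 / 10) - ρ') (by linarith : 0 ≤ 1 + ρ'),
      mul_nonneg (mul_nonneg (by linarith : 0 ≤ -(3 / 10) - ρ') (by linarith : 0 ≤ 1 + ρ'))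
        (by linarith : 0 ≤ -ρ'), mul_nonneg (mul_nonneg (by linarith : 0 ≤ -ρ')
        (by linarith : 0 ≤ 1 - ρ')) (sub_nonneg.2 ha')]
  · simpa using g0
  · simpa using l0
  · have h5 : (ρ'' * (ρ'' - 1)) * (ρ'' + a) = 1 := by linear_combination e2
    have h6 : 2 ≤ ρ'' * (ρ'' - 1) := by nlinarith
    have : a - 1 < -ρ'' := by nlinarith
    simpa using this

theorem secondConjugates_of_roots {a : ℕ} (ha : 5 ≤ a) {ψ ψ' ψ'' : ℝ}
    (h : AreEnnolaRootsSecond a ψ ψ' ψ'') : SecondConjugates a (-![ψ'', ψ', ψ]) := by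
  obtain ⟨e0, e1, e2, h1, h2⟩ := h
  have ha' : (5 : ℝ) ≤ a := by exact_mod_cast ha
  obtain ⟨hs, -, hp⟩ := vieta_of_roots (b := -(a - 1)) (c := -a) (d := -1) (x := ψ'') (y := ψ')
    (z := ψ) (by linarith) (by linarith) (by linarith) h1.ne' (h1.trans h2).ne h2.ne
  have loc : ∀ x : ℝ, x ^ 3 - ((a : ℝ) - 1) * x ^ 2 - a * x - 1 = 0 →
      a < x ∨ -(7 / 25) < x ∧ x < 0 ∨ -1 < x ∧ x < -(19 / 25) := by
    intro x hx
    have e : x * (x + 1) * (x - a) = 1 := by linear_combination hx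
    rcases lt_or_ge (a : ℝ) x with h3 | h3
    · exact .inl h3
    have h4 : x * (x + 1) < 0 := by
      by_contra hcon
      nlinarith [mul_nonneg (not_lt.1 hcon) (sub_nonneg.2 h3)]
    have h5 : x < 0 := by nlinarith
    have h6 : -1 < x := by nlinarith
    rcases lt_or_ge (-(7 / 25)) x with h7 | h7
    · exact .inr (.inl ⟨h7, h5⟩)
    rcases lt_or_ge x (-(19 / 25)) with h8 | h8
    · exact .inr (.inr ⟨h6, h8⟩)
    -- The factor `126 / 25 - x` makes the triple product differ from `x (x + 1) (x - 5)` by a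
    -- linear polynomial, which shows that the latter exceeds `1` on the interval.
    nlinarith [mul_nonneg (mul_nonneg (by linarith : 0 ≤ -(7 / 25) - x)
      (by linarith : 0 ≤ x + 19 / 25)) (by linarith : 0 ≤ 126 / 25 - x),
      mul_nonneg (neg_nonneg.2 h4.le) (sub_nonneg.2 ha')]
  have g0 : a < ψ := by
    rcases loc ψ e0 with h3 | ⟨-, h3⟩ | ⟨-, h3⟩
    · exact h3
    all_goals
      have h4 : ψ < 0 := by linarith
      nlinarith [mul_pos_of_neg_of_neg h4 (h2.trans h4)]
  have g2 : -(7 / 25) < ψ'' ∧ ψ'' < 0 := by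
    rcases loc ψ'' e2 with h3 | h3 | h3
    · rcases loc ψ' e1 with h4 | h4 | h4 <;> linarith
    · exact h3
    · nlinarith
  have g1 : -1 < ψ' ∧ ψ' < -(19 / 25) := by
    rcases loc ψ' e1 with h3 | h3 | h3
    · linarith
    · linarith
    · exact h3
  refine ⟨ha', ?_, ?_, ?_, ?_, ?_, ?_, ?_, ?_⟩
  · intro i
    fin_cases i <;> simp <;> linarith
  all_goals simp
  all_goals linarith

/-! ### Semiconvergents that decompose -/

theorem cubic_eq_mul {b c : ℤ} {r : Fin 3 → ℝ} (hs : r 0 + r 1 + r 2 = -b)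
    (hq : r 0 * r 1 + r 0 * r 2 + r 1 * r 2 = c) (hp : r 0 * r 1 * r 2 = 1) (x : ℝ) :
    x ^ 3 + b * x ^ 2 + c * x - 1 = (x - r 0) * (x - r 1) * (x - r 2) := by
  linear_combination x ^ 2 * hs - x * hq + hp

theorem mem_jpaSemiconvergents_three {β : Fin 3 → ℝ} {k : ℕ} {x y z : ℝ}
    (h : jpa β k = ![x, y, z]) (hx : 0 < x) (j : ℕ) (hj : (j + 1) * x ≤ z) :
    z - j * x ∈ jpaSemiconvergents β := by
  refine ⟨k, 1, j, ?_, by simp [h]⟩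
  have : ((j : ℤ) + 1) ≤ ⌊z / x⌋ := by
    rw [Int.le_floor, le_div_iff₀ hx]
    push_cast
    exact hj
  have e : jpa β k (Fin.succ 1) / jpa β k 0 = z / x := by simp [h]
  rw [e]
  linarith

theorem jpa_succ_eq {β : Fin 3 → ℝ} {k : ℕ} {x y z : ℝ} (h : jpa β k = ![x, y, z]) (p q : ℤ)
    (hx : 0 < x) (hy0 : 0 ≤ y - p * x) (hy1 : y - p * x < x) (hz0 : 0 ≤ z - q * x)
    (hz1 : z - q * x < x) : jpa β (k + 1) = ![y - p * x, z - q * x, x] := by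
  rw [← jpaStep_three (floor_div_eq hx hy0 hy1) (floor_div_eq hx hz0 hz1), ← h]
  exact Function.iterate_succ_apply' _ _ _

open Polynomial in
theorem decomposableInItsSignature_of_coords {r : Fin 3 → ℝ} {b c : ℤ} {i : Fin 3} {δ : ℝ}
    (hr : ∀ x : ℝ, x ^ 3 + b * x ^ 2 + c * x - 1 = (x - r 0) * (x - r 1) * (x - r 2))
    (u v w u' v' w' : ℤ)
    (hpos : ∀ j, 0 < (u + v * r j + w * r j ^ 2) * (u' + v' * r j + w' * r j ^ 2))
    (hδ : δ = (u + u') + (v + v') * r i + (w + w') * r i ^ 2) :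
    DecomposableInItsSignature (r i) δ := by
  have ev : ∀ (x : ℝ) (u v w : ℤ), aeval x (C u + C v * X + C w * X ^ 2 : ℤ[X]) =
      u + v * x + w * x ^ 2 := fun x u v w => by simp
  refine decomposableInItsSignature_of_aeval hr (C u + C v * X + C w * X ^ 2)
    (C u' + C v' * X + C w' * X ^ 2) (fun j => by rw [ev, ev]; exact hpos j) ?_
  rw [map_add, ev, ev, hδ]
  ring

/-- The semiconvergent `1 - a (ρ - 1)` equals `(ρ - 1) / ρ + ρ (ρ - 1)`. The quotient of the
summands is a square, so their signs agree in every embedding. -/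
theorem exists_decomposable_rho {a : ℕ} (ha : 3 ≤ a) {r : Fin 3 → ℝ}
    (h : FirstConjugates a (-r)) (hr : ∀ x : ℝ,
      x ^ 3 + (a - 1 : ℤ) * x ^ 2 + (-a : ℤ) * x - 1 = (x - r 0) * (x - r 1) * (x - r 2)) :
    ∃ δ ∈ jpaSemiconvergents ![1, r 1, r 1 ^ 2], DecomposableInItsSignature (r 1) δ := by
  have root : ∀ i, r i ^ 3 + (a - 1) * r i ^ 2 - a * r i - 1 = 0 := by
    intro i
    have := hr (r i)
    push_cast at this
    rw [show (r i - r 0) * (r i - r 1) * (r i - r 2) = 0 by fin_cases i <;> simp] at this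
    linarith
  have ha' : (3 : ℝ) ≤ a := by exact_mod_cast ha
  have g0 : 1 < r 1 := by have := h.one_lt; rw [Pi.neg_apply] at this; linarith
  have r1 := root 1
  have key : (a + 1) * (r 1 - 1) ≤ 1 := by
    have e : r 1 * ((a + 1) * (r 1 - 1) + (r 1 - 1) ^ 2) = 1 := by linear_combination r1
    by_contra hcon
    nlinarith [sq_nonneg (r 1 - 1)]
  have l0 : r 1 ≤ 5 / 4 := by nlinarith
  have s0 : jpa ![1, r 1, r 1 ^ 2] 0 = ![1, r 1, r 1 ^ 2] := rfl
  have s1 := jpa_succ_eq s0 1 1 one_pos (by push_cast; linarith) (by push_cast; linarith)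
    (by push_cast; nlinarith) (by push_cast; nlinarith)
  refine ⟨_, mem_jpaSemiconvergents_three s1 (by push_cast; linarith) a
    (by push_cast; linarith), ?_⟩
  refine decomposableInItsSignature_of_coords hr (a + 1) (1 - a) (-1) 0 (-1) 1 ?_
    (by push_cast; ring)
  intro j
  have hj := root j
  have hne : r j ≠ 1 := by
    intro h1
    rw [h1] at hj
    linarith
  have := sub_ne_zero.2 hne
  calc (0 : ℝ) < (r j - 1) ^ 2 := by positivity
    _ = _ := by push_cast; linear_combination (r j - 1) * hj

/-- The quotients are `(a - 1, a² - 1)`, `(0, 1)`, `(0, 1)`; the bound on `(4 a - 1) e` keeps the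
last `1` from being `2`. -/
theorem jpa_three_steps {a : ℕ} (ha : (3 : ℝ) ≤ a) {e : ℝ} (h0 : 0 < e)
    (h1 : (4 * a - 1) * e < 1) : jpa ![1, a - e, (a - e) ^ 2] 3 =
      ![e, (2 * a - 1) * e - e ^ 2, 1 - 2 * a * e + e ^ 2] := by
  have hae : 3 * e ≤ a * e := mul_le_mul_of_nonneg_right ha h0.le
  have he : e < 1 / 11 := by linarith
  have b0 : 0 < e ^ 2 := by positivity
  have b1 : e ^ 2 < 1 / 11 * e := by nlinarith
  have s0 : jpa ![1, a - e, (a - e) ^ 2] 0 = ![1, a - e, (a - e) ^ 2] := rfl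
  have s1 := jpa_succ_eq s0 (a - 1) (a ^ 2 - 1) one_pos (by push_cast; linarith)
    (by push_cast; linarith) (by push_cast; linarith) (by push_cast; linarith)
  have s2 := jpa_succ_eq s1 0 1 (by push_cast; linarith) (by push_cast; linarith)
    (by push_cast; linarith) (by push_cast; linarith) (by push_cast; linarith)
  have s3 := jpa_succ_eq s2 0 1 (by push_cast; linarith) (by push_cast; linarith)
    (by push_cast; linarith) (by push_cast; linarith) (by push_cast; linarith)
  rw [s3]
  push_cast
  congr 1
  · ring
  congr 1
  · ring
  congr 1
  ring

/-- Two quadratic polynomials that have the same sign at every root of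
`x (x - 1) (x + a) = 1`. -/
theorem mul_pos_of_root {a x : ℝ} (ha : 3 ≤ a) (hx : x * (x - 1) * (x + a) = 1)
    (hloc : (x < 0 ∧ -a * x < 1) ∨ 1 < x ∨ x < -1 ∧ (a ^ 2 * (x + a) < 1 ∧ x + a < 1)) :
    0 < (-a + -(a - 1) ^ 2 * x + (2 - a) * x ^ 2) *
      (1 - a ^ 2 + ((a - 1) ^ 2 - 1) * x + (a - 1) * x ^ 2) := by
  rcases hloc with ⟨h0, h1⟩ | h1 | ⟨h1, h2, h3⟩
  · have hx2 : a * x ^ 2 ≤ -x := by nlinarith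
    have h4 : -3 * x < 1 := by nlinarith
    refine mul_pos_of_neg_of_neg ?_ ?_
    · nlinarith [sq_nonneg x]
    · nlinarith [sq_nonneg x, mul_nonneg (by nlinarith : 0 ≤ (a - 1) ^ 2 - 1) (neg_nonneg.2 h0.le)]
  · refine mul_pos_of_neg_of_neg ?_ ?_
    · have := mul_nonneg (sq_nonneg (a - 1)) (by linarith : 0 ≤ x)
      have := mul_nonneg (by linarith : 0 ≤ a - 2) (sq_nonneg x)
      linarith
    · have k : x * ((a + 1) * (x - 1) + (x - 1) ^ 2) = 1 := by linear_combination hx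
      have k1 : (a + 1) * (x - 1) + (x - 1) ^ 2 < 1 := by
        by_contra hcon
        nlinarith
      have := mul_lt_mul_of_pos_left k1 (by linarith : 0 < a - 1)
      linarith
  -- In terms of `e` the factors are `e (a² - 2 a - 1 - (a - 2) e)` and `1 - a² e + (a - 1) e²`.
  · obtain ⟨e, rfl⟩ : ∃ e, x = e - a := ⟨x + a, by ring⟩
    have hpos : 0 < (e - a) * (e - a - 1) := mul_pos_of_neg_of_neg (by linarith) (by linarith)
    have e0 : 0 < e := by
      by_contra hcon
      nlinarith [mul_nonneg hpos.le (neg_nonneg.2 (not_lt.1 hcon))]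
    rw [sub_add_cancel] at h2 h3
    refine mul_pos ?_ ?_
    · have h4 : (a - 2) * e ≤ a - 2 := mul_le_of_le_one_right (by linarith) h3.le
      have : 0 < e * (a ^ 2 - 2 * a - 1 - (a - 2) * e) := mul_pos e0 (by nlinarith)
      linarith
    · have : 0 < (a - 1) * e ^ 2 := mul_pos (by linarith) (by positivity)
      linarith

/-- With `e = ρ'' + a` the semiconvergent is `1 - (2 a + 1) e + e²`, found after three steps with `j
= 1`. Both summands have the signs `-, -, +` at `ρ'`, `ρ`, `ρ''`. -/
theorem exists_decomposable_rho'' {a : ℕ} (ha : 3 ≤ a) {r : Fin 3 → ℝ}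
    (h : FirstConjugates a (-r)) (hr : ∀ x : ℝ,
      x ^ 3 + (a - 1 : ℤ) * x ^ 2 + (-a : ℤ) * x - 1 = (x - r 0) * (x - r 1) * (x - r 2)) :
    ∃ δ ∈ jpaSemiconvergents ![1, -r 2, r 2 ^ 2], DecomposableInItsSignature (r 2) δ := by
  have ha' : (3 : ℝ) ≤ a := by exact_mod_cast ha
  obtain ⟨-, root, -, -, h0, -, h1, h1', h2⟩ := id h
  have hat := h.mul_lt_one
  simp only [Pi.neg_apply] at root h0 h1 h1' h2 hat
  obtain ⟨e, he⟩ : ∃ e, r 2 = e - a := ⟨r 2 + a, by ring⟩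
  have re : (a - e) * (a + 1 - e) * e = 1 := by
    have := root 2
    rw [he] at this
    linear_combination this
  have e1 : e < 1 := by linarith
  have hpos : 0 < (a - e) * (a + 1 - e) := mul_pos (by linarith) (by linarith)
  have e0 : 0 < e := by
    by_contra hcon
    nlinarith [mul_nonneg hpos.le (neg_nonneg.2 (not_lt.1 hcon))]
  -- Bootstrapping: each bound on `e` improves the lower bound for `(a - e) (a + 1 - e) = 1 / e`.
  have e2 : e < 1 / 4 := by
    have : 6 ≤ (a - e) * (a + 1 - e) := by nlinarith
    nlinarith
  have e3 : e < 1 / 9 := by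
    have : 9 < (a - e) * (a + 1 - e) := by nlinarith
    nlinarith
  have b1 : (4 * a - 1) * e < 1 := by
    have : 4 * a - 1 < (a - e) * (a + 1 - e) := by nlinarith
    nlinarith
  have b2 : a ^ 2 * e < 1 := by
    have : (a : ℝ) ^ 2 < (a - e) * (a + 1 - e) := by nlinarith
    nlinarith
  have s3 := jpa_three_steps ha' e0 b1
  rw [show -r 2 = a - e by rw [he]; ring, show r 2 ^ 2 = (a - e) ^ 2 by rw [he]; ring]
  refine ⟨_, mem_jpaSemiconvergents_three s3 e0 1 (by push_cast; nlinarith), ?_⟩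
  refine decomposableInItsSignature_of_coords hr (-a) (-(a - 1) ^ 2) (2 - a) (1 - a ^ 2)
    ((a - 1) ^ 2 - 1) (a - 1) ?_ (by rw [he]; push_cast; ring)
  intro j
  push_cast
  refine mul_pos_of_root ha' (by linear_combination root j) ?_
  fin_cases j
  · exact .inl ⟨by simpa using h0, by simpa using hat⟩
  · exact .inr (.inl (by simpa using neg_lt_neg h1))
  · refine .inr (.inr ⟨?_, ?_, ?_⟩) <;> simp only [Fin.reduceFinMk, he] <;> linarith

/-- The semiconvergent is `ψ² - 2 = ψ + (ψ + 1) (ψ - 2)`. At each root `x (x + 1)` has the sign of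
`x - a`, which is also that of `x - 2`, as no root lies between `2` and `a`. -/
theorem exists_decomposable_psi {a : ℕ} (ha : 5 ≤ a) {r : Fin 3 → ℝ} (hr : ∀ x : ℝ,
      x ^ 3 + (1 - a : ℤ) * x ^ 2 + (-a : ℤ) * x - 1 = (x - r 0) * (x - r 1) * (x - r 2))
    (h2 : a < r 2) :
    ∃ δ ∈ jpaSemiconvergents ![1, r 2, r 2 ^ 2], DecomposableInItsSignature (r 2) δ := by
  have ha' : (5 : ℝ) ≤ a := by exact_mod_cast ha
  have s0 : jpa ![1, r 2, r 2 ^ 2] 0 = ![1, r 2, r 2 ^ 2] := rfl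
  refine ⟨_, mem_jpaSemiconvergents_three s0 one_pos 2 (by push_cast; nlinarith), ?_⟩
  refine decomposableInItsSignature_of_coords hr 0 1 0 (-2) (-1) 1 ?_ (by push_cast; ring)
  intro j
  have hj := hr (r j)
  push_cast at hj ⊢
  rw [show (r j - r 0) * (r j - r 1) * (r j - r 2) = 0 by fin_cases j <;> simp] at hj
  generalize r j = x at hj
  have e : x * (x + 1) * (x - a) = 1 := by linear_combination hj
  rw [show (0 + 1 * x + 0 * x ^ 2) * (-2 + -1 * x + 1 * x ^ 2) = x * (x + 1) * (x - 2) by ring]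
  rcases lt_or_ge (a : ℝ) x with h3 | h3
  · exact mul_pos (mul_pos (by linarith) (by linarith)) (by linarith)
  have h4 : x * (x + 1) < 0 := by
    by_contra hcon
    nlinarith [mul_nonneg (not_lt.1 hcon) (sub_nonneg.2 h3)]
  exact mul_pos_of_neg_of_neg h4 (by nlinarith)

theorem theorem1p4 :
    (∀ a : ℕ, 3 ≤ a → ∀ ρ ρ' ρ'' : ℝ, AreEnnolaRootsFirst a ρ ρ' ρ'' →
      (∀ δ ∈ jpaSemiconvergents ![1, -ρ', ρ' ^ 2], IndecomposableInItsSignature ρ' δ) ∧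
      (∃ δ ∈ jpaSemiconvergents ![1, ρ, ρ ^ 2], DecomposableInItsSignature ρ δ) ∧
      (∃ δ ∈ jpaSemiconvergents ![1, -ρ'', ρ'' ^ 2], DecomposableInItsSignature ρ'' δ)) ∧
    (∀ a : ℕ, 5 ≤ a → ∀ ψ ψ' ψ'' : ℝ, AreEnnolaRootsSecond a ψ ψ' ψ'' →
      (∀ δ ∈ jpaSemiconvergents ![1, -ψ', ψ' ^ 2], IndecomposableInItsSignature ψ' δ) ∧
      (∀ δ ∈ jpaSemiconvergents ![1, -ψ'', ψ'' ^ 2], IndecomposableInItsSignature ψ'' δ) ∧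
      (∃ δ ∈ jpaSemiconvergents ![1, ψ, ψ ^ 2], DecomposableInItsSignature ψ δ)) := by
  constructor
  · intro a ha ρ ρ' ρ'' h
    have hc := firstConjugates_of_roots ha h
    obtain ⟨e0, e1, e2, h1, h2⟩ := h
    obtain ⟨hs, hq, hp⟩ := vieta_of_roots (b := a - 1) (c := -a) (d := -1) (x := ρ') (y := ρ)
      (z := ρ'') (by linarith) (by linarith) (by linarith) h2.ne (h1.trans h2).ne' h1.ne'
    have hr := cubic_eq_mul (b := a - 1) (c := -a) (r := ![ρ', ρ, ρ'']) (by simpa using hs)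
      (by simpa using hq) (by simpa using hp)
    have hρ := exists_decomposable_rho ha hc hr
    have hρ' := exists_decomposable_rho'' ha hc hr
    refine ⟨fun δ hδ => ?_, by simpa using hρ, by simpa using hρ'⟩
    have := hc.semiconvergents δ (by simpa using hδ)
    have e : Algebra.adjoin ℤ {-![ρ', ρ, ρ'']} = Algebra.adjoin ℤ {![ρ', ρ, ρ'']} :=
      adjoin_neg_eq _
    rw [e] at this
    simpa using this.indecomposableInItsSignature (by omega) (by omega) hr
  · intro a ha ψ ψ' ψ'' h
    have hc := secondConjugates_of_roots ha h
    obtain ⟨e0, e1, e2, h1, h2⟩ := h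
    obtain ⟨hs, hq, hp⟩ := vieta_of_roots (b := 1 - a) (c := -a) (d := -1) (x := ψ'')
      (y := ψ') (z := ψ) (by linarith) (by linarith) (by linarith) h1.ne' (h1.trans h2).ne h2.ne
    have hr := cubic_eq_mul (b := 1 - a) (c := -a) (r := ![ψ'', ψ', ψ]) (by simpa using hs)
      (by simpa using hq) (by simpa using hp)
    have hψ := exists_decomposable_psi ha hr (by simpa using hc.two_lt)
    have e : Algebra.adjoin ℤ {-![ψ'', ψ', ψ]} = Algebra.adjoin ℤ {![ψ'', ψ', ψ]} :=
      adjoin_neg_eq _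
    refine ⟨fun δ hδ => ?_, fun δ hδ => ?_, by simpa using hψ⟩
    · have := hc.semiconvergents_one δ (by simpa using hδ)
      rw [e] at this
      simpa using this.indecomposableInItsSignature (by omega) (by omega) hr
    · have := hc.semiconvergents_zero δ (by simpa using hδ)
      rw [e] at this
      simpa using this.indecomposableInItsSignature (by omega) (by omega) hr
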